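/- Let $d\ge 1$, $\mu_*\in\mathbb R^d$, and let $\Sigma_*\in\mathbb R^{d\times d}$ be symmetric and (strictly) positive definite. Let $X_1,\dots,X_n$ be i.i.d. with law $\mathcal N(\mu_*,\Sigma_*)$, and let $$\widehat\mu_n=\bar X:=\frac1n\sum_{i=1}^n X_i,\qquad \widehat\Sigma_n=\frac1n\sum_{i=1}^n (X_i-\bar X)(X_i-\bar X)^\top$$ be the Gaussian maximum likelihood estimators (for unknown mean and covariance). Let $$\widetilde{\mathcal E}_n:=\mathbb E\Big[D_{\mathrm{KL}}\big(\mathcal N(\widehat\mu_n,\widehat\Sigma_n)\,\big\|\,\mathcal N(\mu_*,\Sigma_*)\big)\Big]\in[0,\infty],$$ where $\mathcal N(\mu,\Sigma)$ is the (degenerate) Gaussian law when $\Sigma$ is singular, and $D_{\mathrm{KL}}(P\|Q)=\mathbb E_{P}[\log\frac{dP}{dQ}]$, which is $+\infty$ if $P$ is not absolutely continuous with respect to $Q$. Let $\psi(z)=\frac{d}{dz}\log\Gamma(z)$ be the digamma function. Then: 1. If $n\ge d+1$, then $\widetilde{\mathcal E}_n$ is finite and $$\widetilde{\mathcal E}_n=\frac12\Big(d\log(n/2)-\sum_{j=1}^d\psi\Big(\frac{n-j}{2}\Big)\Big).$$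 2. $\widetilde{\mathcal E}_n$ is strictly decreasing in $n$ for integers $n\ge d+1$. 3. If $n\le d$, then $\widetilde{\mathcal E}_n=+\infty$. -/

import Mathlib

open MeasureTheory ProbabilityTheory InformationTheory
open scoped ENNReal

/-- The digamma function of a real variable, `ψ(z) = d/dz log Γ(z)` (used for `z > 0` only). -/
noncomputable def realDigamma (z : ℝ) : ℝ :=
  deriv (fun t : ℝ => Real.log (Real.Gamma t)) z

/-- The Gaussian maximum likelihood estimate of the mean: the empirical mean
`x̄ = (1/n) ∑ᵢ xᵢ` of the sample `x₁, …, xₙ ∈ ℝᵈ`. -/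
noncomputable def sampleMean {d n : ℕ} (x : Fin n → EuclideanSpace ℝ (Fin d)) :
    EuclideanSpace ℝ (Fin d) :=
  (n : ℝ)⁻¹ • ∑ i, x i

/-- The Gaussian maximum likelihood estimate of the covariance:
`(1/n) ∑ᵢ (xᵢ - x̄)(xᵢ - x̄)ᵀ`. -/
noncomputable def sampleCov {d n : ℕ} (x : Fin n → EuclideanSpace ℝ (Fin d)) :
    Matrix (Fin d) (Fin d) ℝ :=
  (n : ℝ)⁻¹ • ∑ i, Matrix.vecMulVec (x i - sampleMean x).ofLp (x i - sampleMean x).ofLp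

/-- The expected reverse Kullback-Leibler risk
`E[ D_KL( N(μ̂ₙ, Σ̂ₙ) ‖ N(μ, S) ) ] ∈ [0, ∞]` of the Gaussian maximum likelihood estimates
computed from the random sample `X₁, …, Xₙ` on the probability space `(Ω, P)`. -/
noncomputable def reverseKLRisk {Ω : Type*} [MeasurableSpace Ω] (P : Measure Ω) {d n : ℕ}
    (X : Fin n → Ω → EuclideanSpace ℝ (Fin d))
    (μ : EuclideanSpace ℝ (Fin d)) (S : Matrix (Fin d) (Fin d) ℝ) : ℝ≥0∞ :=
  ∫⁻ ω, klDiv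
      (multivariateGaussian (sampleMean fun i => X i ω) (sampleCov fun i => X i ω))
      (multivariateGaussian μ S) ∂P

/-! Whitening the sample by an affine bijection changes neither side of the divergence, so the
reference law may be taken standard. Then the divergence is `1/2 (tr T + ‖m‖² - d - log det T)`. At
the estimates, `tr T + ‖m‖²` is the empirical second moment, whose mean is exactly `d`; only `-1/2 E
log det` of the empirical covariance survives.

Up to the factor `n⁻¹`, that covariance is the Gram matrix of the columns of the data matrix
projected orthogonally to the ones vector. The columns are `d` independent standard Gaussian vectors
in `ℝⁿ` (`map_sampleColumns`). Peeling them off one at a time (`orthogonalGramDet_cons`) writes the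
determinant as a product of squared distances to growing subspaces, so its moments are products of
chi-squared moments with `n - 1, …, n - d` degrees of freedom (`lintegral_orthogonalGramDet_rpow`).
Differentiating the log-moment at order zero yields the digamma sum
(`integral_log_orthogonalGramDet`).

Strict decrease is termwise: with `x = (n - j)/2`, `log((n+1)/n) ≤ 1/n ≤ 1/(2x) < ψ(x + 1/2) -
ψ(x)`. For `n ≤ d` the estimated law is carried by a hyperplane, which is null for a nondegenerate
Gaussian. -/

/-! ### Digamma increments and monotonicity of the closed form. -/

lemma hasDerivAt_log_Gamma {x : ℝ} (hx : 0 < x) :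
    HasDerivAt (fun t : ℝ => Real.log (Real.Gamma t)) (realDigamma x) x := by
  refine DifferentiableAt.hasDerivAt ((Real.differentiableAt_Gamma fun m => ?_).log
    (Real.Gamma_pos_of_pos hx).ne')
  have : (0 : ℝ) ≤ m := m.cast_nonneg
  linarith

lemma realDigamma_add_one {x : ℝ} (hx : 0 < x) : realDigamma (x + 1) = realDigamma x + 1 / x := by
  have h1 : HasDerivAt (fun t : ℝ => Real.log (Real.Gamma (t + 1))) (realDigamma (x + 1)) x :=
    (hasDerivAt_log_Gamma (by linarith : 0 < x + 1)).comp_add_const x 1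
  have h2 : HasDerivAt (fun t : ℝ => Real.log (Real.Gamma t) + Real.log t)
      (realDigamma x + x⁻¹) x := (hasDerivAt_log_Gamma hx).add (Real.hasDerivAt_log hx.ne')
  have h3 : (fun t : ℝ => Real.log (Real.Gamma (t + 1))) =ᶠ[nhds x]
      fun t : ℝ => Real.log (Real.Gamma t) + Real.log t := by
    filter_upwards [lt_mem_nhds hx] with t ht
    rw [Real.Gamma_add_one ht.ne', Real.log_mul ht.ne' (Real.Gamma_pos_of_pos ht).ne', add_comm]
  rw [one_div]
  exact h1.unique (h2.congr_of_eventuallyEq h3)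

lemma realDigamma_monotoneOn : MonotoneOn realDigamma (Set.Ioi 0) :=
  Real.convexOn_log_Gamma.monotoneOn_deriv
    fun _ hx => (hasDerivAt_log_Gamma hx).differentiableAt

/-- By monotonicity the half-step increment lies between zero and the full-step increment `1 / (x +
N)`. -/
lemma tendsto_realDigamma_sub (x : ℝ) :
    Filter.Tendsto (fun N : ℕ => realDigamma (x + N + 1 / 2) - realDigamma (x + N)
      - 1 / (2 * (x + N))) Filter.atTop (nhds 0) := by
  have hN : Filter.Tendsto (fun N : ℕ => x + (N : ℝ)) Filter.atTop Filter.atTop :=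
    Filter.tendsto_atTop_add_const_left _ _ tendsto_natCast_atTop_atTop
  have h1 : Filter.Tendsto (fun N : ℕ => 1 / (x + (N : ℝ))) Filter.atTop (nhds 0) :=
    hN.const_div_atTop 1
  have h2 : Filter.Tendsto (fun N : ℕ => realDigamma (x + N + 1 / 2) - realDigamma (x + N))
      Filter.atTop (nhds 0) := by
    refine tendsto_of_tendsto_of_tendsto_of_le_of_le' tendsto_const_nhds h1 ?_ ?_
    · filter_upwards [hN.eventually_gt_atTop 0] with N hN
      have := realDigamma_monotoneOn (a := x + N) (b := x + N + 1 / 2) hN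
        (Set.mem_Ioi.2 (by linarith)) (by linarith)
      linarith
    · filter_upwards [hN.eventually_gt_atTop 0] with N hN
      have := realDigamma_monotoneOn (a := x + N + 1 / 2) (b := x + N + 1)
        (Set.mem_Ioi.2 (by linarith)) (Set.mem_Ioi.2 (by linarith)) (by linarith)
      rw [realDigamma_add_one hN] at this
      linarith
  have h3 : Filter.Tendsto (fun N : ℕ => 1 / (2 * (x + (N : ℝ)))) Filter.atTop (nhds 0) := by
    refine Filter.Tendsto.const_div_atTop (hN.const_mul_atTop two_pos) 1
  simpa using h2.sub h3

/-- The defect `D N` at `x + N` decreases strictly in `N` and tends to zero, so it is positive at `N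
= 0`. -/
lemma one_div_lt_realDigamma_add_half_sub {x : ℝ} (hx : 0 < x) :
    1 / (2 * x) < realDigamma (x + 1 / 2) - realDigamma x := by
  set D : ℕ → ℝ := fun N : ℕ => realDigamma (x + N + 1 / 2) - realDigamma (x + N)
      - 1 / (2 * (x + N)) with hD
  have hstep : ∀ N, D (N + 1) < D N := fun N => by
    have hN : 0 < x + N := by positivity
    have e1 := realDigamma_add_one hN
    have e2 := realDigamma_add_one (x := x + N + 1 / 2) (by linarith)
    simp only [hD]
    push_cast
    rw [show x + (N + 1 : ℝ) = x + N + 1 by ring,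
      show x + N + 1 + 1 / 2 = x + (N : ℝ) + 1 / 2 + 1 by ring, e1, e2]
    generalize x + (N : ℝ) = y at *
    -- Strict midpoint convexity of `1 / y` on the interval from `y` to `y + 1`.
    have : 1 / (y + 1 / 2) - 1 / y - 1 / (2 * (y + 1)) + 1 / (2 * y) < 0 := by
      have : 1 / (y + 1 / 2) - 1 / y - 1 / (2 * (y + 1)) + 1 / (2 * y)
          = - (1 / (4 * y * (y + 1) * (y + 1 / 2))) := by
        field_simp
        ring
      rw [this]
      exact neg_lt_zero.2 (by positivity)
    linarith
  have hanti : StrictAnti D := strictAnti_nat_of_succ_lt hstep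
  -- The limit only gives a weak inequality; applying it at index one leaves a strict step down from
  -- index zero.
  have h0 : 0 ≤ D 1 := hanti.antitone.le_of_tendsto (tendsto_realDigamma_sub x) 1
  have h1 : 0 < D 0 := h0.trans_lt (hanti one_pos)
  simp only [hD, Nat.cast_zero, add_zero] at h1
  linarith

/-- The closed form of the reverse Kullback-Leibler risk is strictly decreasing. -/
lemma strictAntiOn_log_sub_sum_realDigamma {d : ℕ} (hd : 1 ≤ d) :
    StrictAntiOn (fun n : ℕ => 1 / 2 * (d * Real.log ((n : ℝ) / 2)
      - ∑ j ∈ Finset.Icc 1 d, realDigamma (((n : ℝ) - (j : ℝ)) / 2))) (Set.Ici (d + 1)) := by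
  refine strictAntiOn_of_succ_lt (Set.ordConnected_Ici) fun n _ hn _ => ?_
  have hn : d + 1 ≤ n := hn
  have hnd : (d : ℝ) + 1 ≤ n := by exact_mod_cast hn
  have hn0 : (0 : ℝ) < n := by linarith [(d.cast_nonneg : (0 : ℝ) ≤ d)]
  have key : ∀ j ∈ Finset.Icc 1 d, Real.log (((n + 1 : ℕ) : ℝ) / 2) - Real.log ((n : ℝ) / 2)
      < realDigamma ((((n + 1 : ℕ) : ℝ) - (j : ℝ)) / 2) - realDigamma (((n : ℝ) - (j : ℝ)) / 2) := by
    intro j hj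
    have hj1 : (1 : ℝ) ≤ j := by exact_mod_cast (Finset.mem_Icc.1 hj).1
    have hjd : (j : ℝ) ≤ d := by exact_mod_cast (Finset.mem_Icc.1 hj).2
    have h := one_div_lt_realDigamma_add_half_sub (x := ((n : ℝ) - j) / 2) (by linarith)
    have e : (((n + 1 : ℕ) : ℝ) - (j : ℝ)) / 2 = ((n : ℝ) - j) / 2 + 1 / 2 := by push_cast; ring
    rw [e]
    refine lt_of_le_of_lt ?_ h
    rw [← Real.log_div (by positivity) (by positivity)]
    refine (Real.log_le_sub_one_of_pos (by positivity)).trans ?_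
    have : ((n + 1 : ℕ) : ℝ) / 2 / ((n : ℝ) / 2) - 1 = 1 / n := by
      push_cast; field_simp; ring
    rw [this]
    exact one_div_le_one_div_of_le (by linarith) (by linarith)
  have hs := Finset.sum_lt_sum_of_nonempty (Finset.nonempty_Icc.2 hd) key
  simp only [Finset.sum_sub_distrib, Finset.sum_const, Nat.card_Icc, nsmul_eq_mul,
    Nat.add_sub_cancel] at hs
  simp only [Order.succ_eq_add_one]
  linarith

/-! ### The standard Gaussian density and chi-squared moments. -/

section StdGaussian

variable {E : Type*} [NormedAddCommGroup E] [InnerProductSpace ℝ E]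

/-- The Lebesgue density of the standard Gaussian distribution. -/
noncomputable def stdGaussianPDF (x : E) : ℝ :=
  ((Real.pi / (1 / 2)) ^ (Module.finrank ℝ E / 2 : ℝ))⁻¹ * Real.exp (-(1 / 2) * ‖x‖ ^ 2)

lemma stdGaussianPDF_pos (x : E) : 0 < stdGaussianPDF x := by
  unfold stdGaussianPDF; positivity

variable [MeasurableSpace E] [BorelSpace E]

lemma measurable_stdGaussianPDF : Measurable (stdGaussianPDF : E → ℝ) := by
  unfold stdGaussianPDF; fun_prop

variable [FiniteDimensional ℝ E]

lemma integral_stdGaussianPDF : ∫ x : E, stdGaussianPDF x = 1 := by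
  simp only [stdGaussianPDF]
  rw [integral_const_mul, GaussianFourier.integral_rexp_neg_mul_sq_norm (by norm_num)]
  exact inv_mul_cancel₀ (by positivity)

lemma integrable_stdGaussianPDF : Integrable (stdGaussianPDF : E → ℝ) := by
  -- A non-integrable function has integral zero by convention, which contradicts total mass one.
  by_contra h
  have := integral_stdGaussianPDF (E := E)
  rw [integral_undef h] at this
  norm_num at this

/-- Both sides are finite measures with the same characteristic function, by the Gaussian Fourier
integral. -/
lemma stdGaussian_eq_withDensity :
    stdGaussian E = volume.withDensity (fun x => ENNReal.ofReal (stdGaussianPDF x)) := by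
  have : IsFiniteMeasure ((volume : Measure E).withDensity
      (fun x => ENNReal.ofReal (stdGaussianPDF x))) := by
    refine isFiniteMeasure_withDensity ?_
    rw [← ofReal_integral_eq_lintegral_ofReal integrable_stdGaussianPDF
      (ae_of_all _ fun x => (stdGaussianPDF_pos x).le)]
    exact ENNReal.ofReal_ne_top
  refine Measure.ext_of_charFun (funext fun t => ?_)
  rw [charFun_stdGaussian, charFun_apply, integral_withDensity_eq_integral_toReal_smul
    (measurable_stdGaussianPDF.ennreal_ofReal) (ae_of_all _ fun _ => ENNReal.ofReal_lt_top)]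
  have h := GaussianFourier.integral_cexp_neg_mul_sq_norm_add (V := E) (b := 1 / 2)
    (by norm_num) Complex.I t
  have e : ∀ x : E, (ENNReal.ofReal (stdGaussianPDF x)).toReal • Complex.exp (inner ℝ x t * Complex.I)
      = ((Real.pi / (1 / 2) : ℂ) ^ (Module.finrank ℝ E / 2 : ℂ))⁻¹ *
        Complex.exp (-(1 / 2) * ‖x‖ ^ 2 + Complex.I * inner ℝ t x) := by
    intro x
    rw [ENNReal.toReal_ofReal (stdGaussianPDF_pos x).le, stdGaussianPDF, Complex.real_smul,
      Complex.exp_add]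
    push_cast
    rw [Complex.ofReal_cpow (by positivity), real_inner_comm, mul_comm Complex.I]
    push_cast
    ring
  simp_rw [e]
  rw [integral_const_mul, h, ← mul_assoc, inv_mul_cancel₀, one_mul]
  · congr 1
    rw [Complex.I_sq]
    ring
  · rw [Ne, Complex.cpow_eq_zero_iff]
    simp [Real.pi_ne_zero]

lemma stdGaussian_absolutelyContinuous : stdGaussian E ≪ volume := by
  rw [stdGaussian_eq_withDensity]
  exact withDensity_absolutelyContinuous _ _

lemma lintegral_stdGaussian (f : E → ℝ≥0∞) :
    ∫⁻ x, f x ∂(stdGaussian E) = ∫⁻ x, ENNReal.ofReal (stdGaussianPDF x) * f x := by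
  rw [stdGaussian_eq_withDensity, lintegral_withDensity_eq_lintegral_mul_non_measurable _
    measurable_stdGaussianPDF.ennreal_ofReal (ae_of_all _ fun _ => ENNReal.ofReal_lt_top)]
  rfl

/-- Polar coordinates reduce the radial integral to a Gamma integral. The factor independent of `s`,
including the volume of the ball, is deliberately left unevaluated. -/
lemma integrable_and_integral_norm_sq_rpow_mul_stdGaussianPDF [Nontrivial E] {s : ℝ}
    (hs : 0 < (Module.finrank ℝ E : ℝ) / 2 + s) :
    Integrable (fun x : E => stdGaussianPDF x * (‖x‖ ^ 2) ^ s) ∧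
    ∫ x : E, stdGaussianPDF x * (‖x‖ ^ 2) ^ s =
      (((Real.pi / (1 / 2)) ^ (Module.finrank ℝ E / 2 : ℝ))⁻¹ * Module.finrank ℝ E *
        (volume : Measure E).real (Metric.ball 0 1) * 2 ^ ((Module.finrank ℝ E : ℝ) / 2 - 1)) *
        (2 ^ s * Real.Gamma (Module.finrank ℝ E / 2 + s)) := by
  set r := Module.finrank ℝ E with hr
  have hr1 : 1 ≤ r := Module.finrank_pos
  set C := ((Real.pi / (1 / 2)) ^ (r / 2 : ℝ))⁻¹ with hC
  let f : ℝ → ℝ := fun y => C * Real.exp (-(1 / 2) * y ^ 2) * (y ^ 2) ^ s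
  have hf : ∀ y ∈ Set.Ioi (0 : ℝ), y ^ (r - 1) • f y =
      C * (y ^ ((r : ℝ) - 1 + 2 * s) * Real.exp (-(1 / 2) * y ^ (2 : ℝ))) := by
    intro y hy
    have hy : 0 < y := hy
    have e1 : y ^ (r - 1) = y ^ ((r : ℝ) - 1) := by
      rw [← Real.rpow_natCast, Nat.cast_sub hr1, Nat.cast_one]
    have e2 : (y ^ 2) ^ s = y ^ (2 * s) := by
      rw [Real.rpow_mul hy.le, Real.rpow_two]
    simp only [f, smul_eq_mul]
    rw [e1, e2, Real.rpow_add hy, Real.rpow_two]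
    ring
  have hq : -1 < (r : ℝ) - 1 + 2 * s := by linarith
  constructor
  · refine (integrable_fun_norm_addHaar (volume : Measure E) (f := f)).2 ?_
    rw [integrableOn_congr_fun hf measurableSet_Ioi]
    exact (integrableOn_rpow_mul_exp_neg_mul_rpow hq two_pos (by norm_num)).const_mul _
  · have h := integral_fun_norm_addHaar (volume : Measure E) f
    rw [setIntegral_congr_fun measurableSet_Ioi hf, integral_const_mul,
      integral_rpow_mul_exp_neg_mul_rpow two_pos hq (by norm_num)] at h
    refine h.trans ?_
    have e1 : ((r : ℝ) - 1 + 2 * s + 1) / 2 = r / 2 + s := by ring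
    have e2 : (1 / 2 : ℝ) ^ (-((r : ℝ) - 1 + 2 * s + 1) / 2) * (1 / 2)
        = 2 ^ ((r : ℝ) / 2 - 1) * 2 ^ s := by
      rw [one_div, Real.inv_rpow two_pos.le, ← Real.rpow_neg two_pos.le,
        ← Real.rpow_neg_one 2, ← Real.rpow_add two_pos, ← Real.rpow_add two_pos]
      congr 1
      ring
    rw [e1, e2]
    simp only [smul_eq_mul, nsmul_eq_mul]
    ring

/-- Moments of the chi-squared distribution, as moments of the squared norm of a standard
Gaussian vector. -/
lemma lintegral_norm_sq_rpow_stdGaussian [Nontrivial E] {s : ℝ}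
    (hs : 0 < (Module.finrank ℝ E : ℝ) / 2 + s) :
    ∫⁻ x, ENNReal.ofReal (‖x‖ ^ 2) ^ s ∂(stdGaussian E) =
      ENNReal.ofReal (2 ^ s * Real.Gamma (Module.finrank ℝ E / 2 + s) /
        Real.Gamma (Module.finrank ℝ E / 2)) := by
  obtain ⟨hi, he⟩ := integrable_and_integral_norm_sq_rpow_mul_stdGaussianPDF (E := E) hs
  have hpos : (0 : ℝ) < (Module.finrank ℝ E : ℝ) / 2 := by
    have : (0 : ℝ) < Module.finrank ℝ E := by exact_mod_cast Module.finrank_pos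
    positivity
  -- At `s = 0` the moment is the total mass one, which determines the unevaluated constant.
  have h0 := (integrable_and_integral_norm_sq_rpow_mul_stdGaussianPDF (E := E) (s := 0)
    (by simpa using hpos)).2
  simp only [Real.rpow_zero, mul_one, add_zero, one_mul, integral_stdGaussianPDF] at h0
  rw [lintegral_stdGaussian]
  have hae : ∀ᵐ x : E, ENNReal.ofReal (stdGaussianPDF x) * ENNReal.ofReal (‖x‖ ^ 2) ^ s
      = ENNReal.ofReal (stdGaussianPDF x * (‖x‖ ^ 2) ^ s) := by
    -- The origin is excluded because for negative `s` the power of zero is `∞` in `ℝ≥0∞` but `0` in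
    -- `ℝ`.
    have : ∀ᵐ x : E, x ≠ 0 := Measure.ae_ne volume 0
    filter_upwards [this] with x hx
    rw [ENNReal.ofReal_rpow_of_pos (by positivity), ENNReal.ofReal_mul (stdGaussianPDF_pos x).le]
  rw [lintegral_congr_ae hae, ← ofReal_integral_eq_lintegral_ofReal hi
    (ae_of_all _ fun x => mul_nonneg (stdGaussianPDF_pos x).le (by positivity)), he]
  congr 1
  have hG := (Real.Gamma_pos_of_pos hpos).ne'
  generalize ((Real.pi / (1 / 2)) ^ (Module.finrank ℝ E / 2 : ℝ))⁻¹ * Module.finrank ℝ E *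
        (volume : Measure E).real (Metric.ball 0 1) * 2 ^ ((Module.finrank ℝ E : ℝ) / 2 - 1) = K
    at *
  have hK : K = (Real.Gamma (Module.finrank ℝ E / 2))⁻¹ := by
    field_simp
    linarith
  rw [hK]
  ring

/-- The characteristic function sees a functional only through its norm, and precomposing with a
contraction that fixes `W` preserves that norm. -/
lemma map_orthogonalProjection_stdGaussian (W : Submodule ℝ E) :
    (stdGaussian E).map W.orthogonalProjectionOnto = stdGaussian W := by
  refine Measure.ext_of_charFunDual (funext fun L => ?_)
  rw [charFunDual_map, charFunDual_stdGaussian, charFunDual_stdGaussian]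
  have : ‖L.comp W.orthogonalProjectionOnto‖ = ‖L‖ := by
    refine le_antisymm ?_ ?_
    · refine (L.opNorm_comp_le _).trans ?_
      exact mul_le_of_le_one_right (norm_nonneg _) W.orthogonalProjectionOnto_norm_le
    · refine L.opNorm_le_bound (norm_nonneg _) fun x => ?_
      have h := (L.comp W.orthogonalProjectionOnto).le_opNorm (x : E)
      simpa using h
  rw [this]

lemma lintegral_norm_sq_starProjection_rpow_stdGaussian (W : Submodule ℝ E)
    (hW : 1 ≤ Module.finrank ℝ W) {s : ℝ} (hs : 0 < (Module.finrank ℝ W : ℝ) / 2 + s) :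
    ∫⁻ x, ENNReal.ofReal (‖W.starProjection x‖ ^ 2) ^ s ∂(stdGaussian E) =
      ENNReal.ofReal (2 ^ s * Real.Gamma (Module.finrank ℝ W / 2 + s) /
        Real.Gamma (Module.finrank ℝ W / 2)) := by
  have : Nontrivial W := Module.finrank_pos_iff.1 hW
  rw [← lintegral_norm_sq_rpow_stdGaussian hs, ← map_orthogonalProjection_stdGaussian,
    lintegral_map (by fun_prop) (by fun_prop)]
  rfl

end StdGaussian

/-! ### Gram determinants of independent standard Gaussian vectors. -/

section Gram

variable {E : Type*} [NormedAddCommGroup E] [InnerProductSpace ℝ E] [FiniteDimensional ℝ E]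

/-- The Gram determinant of the components of `U` orthogonal to the subspace `V`. -/
noncomputable def orthogonalGramDet (V : Submodule ℝ E) {k : ℕ} (U : Fin k → E) : ℝ :=
  (Matrix.gram ℝ fun i => Vᗮ.starProjection (U i)).det

lemma orthogonalGramDet_nonneg (V : Submodule ℝ E) {k : ℕ} (U : Fin k → E) :
    0 ≤ orthogonalGramDet V U :=
  (Matrix.posSemidef_gram ℝ _).det_nonneg

/-- One Gram–Schmidt step: the right side is orthogonal to `V` and to `u`, and differs from `x` by
an element of the enlarged subspace. -/
lemma starProjection_orthogonal_sup_span_singleton (V : Submodule ℝ E) (u x : E)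
    (hu : Vᗮ.starProjection u ≠ 0) :
    (V ⊔ Submodule.span ℝ {u})ᗮ.starProjection x = Vᗮ.starProjection x -
      (inner ℝ (Vᗮ.starProjection x) (Vᗮ.starProjection u) /
        inner ℝ (Vᗮ.starProjection u) (Vᗮ.starProjection u)) • Vᗮ.starProjection u := by
  set p := Vᗮ.starProjection u with hp
  set q := Vᗮ.starProjection x with hq
  have hpV : p ∈ Vᗮ := Submodule.starProjection_apply_mem _ _
  have hqV : q ∈ Vᗮ := Submodule.starProjection_apply_mem _ _
  have hup : u - p ∈ V := by
    have := Vᗮ.sub_starProjection_mem_orthogonal u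
    rwa [Submodule.orthogonal_orthogonal] at this
  have hxq : x - q ∈ V := by
    have := Vᗮ.sub_starProjection_mem_orthogonal x
    rwa [Submodule.orthogonal_orthogonal] at this
  have hpu : ∀ w ∈ Vᗮ, inner ℝ w u = inner ℝ w p := fun w hw => by
    have := Submodule.inner_left_of_mem_orthogonal hup hw
    rw [inner_sub_right] at this
    linarith
  refine (Submodule.eq_starProjection_of_mem_orthogonal
    (K := (V ⊔ Submodule.span ℝ {u})ᗮ) ?_ ?_)
  · rw [← Submodule.inf_orthogonal]
    have hmem : q - (inner ℝ q p / inner ℝ p p) • p ∈ Vᗮ :=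
      Submodule.sub_mem _ hqV (Submodule.smul_mem _ _ hpV)
    refine ⟨hmem, Submodule.mem_orthogonal_singleton_iff_inner_left.2 ?_⟩
    rw [hpu _ hmem, inner_sub_left, real_inner_smul_left,
      div_mul_cancel₀ _ (inner_self_ne_zero.2 hu), sub_self]
  · rw [Submodule.orthogonal_orthogonal]
    have e : x - (q - (inner ℝ q p / inner ℝ p p) • p) =
        (x - q - (inner ℝ q p / inner ℝ p p) • (u - p)) + (inner ℝ q p / inner ℝ p p) • u := by
      module
    rw [e]
    exact Submodule.add_mem_sup (Submodule.sub_mem _ hxq (Submodule.smul_mem _ _ hup))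
      (Submodule.smul_mem _ _ (Submodule.mem_span_singleton_self u))

/-- Squared volume is squared height times squared base. Eliminating with the first row of the Gram
matrix leaves the Gram matrix relative to the enlarged subspace as the minor. -/
lemma orthogonalGramDet_cons (V : Submodule ℝ E) {k : ℕ} (u : E) (U : Fin k → E) :
    orthogonalGramDet V (Fin.cons u U : Fin (k + 1) → E) =
      ‖Vᗮ.starProjection u‖ ^ 2 * orthogonalGramDet (V ⊔ Submodule.span ℝ {u}) U := by
  by_cases hu : Vᗮ.starProjection u = 0
  · rw [hu, norm_zero, zero_pow two_ne_zero, zero_mul]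
    exact Matrix.det_eq_zero_of_row_eq_zero 0 fun j => by
      change inner ℝ (Vᗮ.starProjection u) _ = 0
      rw [hu, inner_zero_left]
  set p := Vᗮ.starProjection u with hp
  have hpp : inner ℝ p p ≠ 0 := inner_self_ne_zero.2 hu
  -- The multipliers clear column zero below the pivot; the entry `0` leaves the pivot row
  -- unchanged.
  let c : Fin (k + 1) → ℝ :=
    Fin.cons 0 fun i => inner ℝ (Vᗮ.starProjection (U i)) p / inner ℝ p p
  let B : Matrix (Fin (k + 1)) (Fin (k + 1)) ℝ := fun i j =>
    Matrix.gram ℝ (fun i => Vᗮ.starProjection ((Fin.cons u U : Fin (k + 1) → E) i)) i j -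
      c i * inner ℝ p (Vᗮ.starProjection ((Fin.cons u U : Fin (k + 1) → E) j))
  have hB0 : ∀ i : Fin k, B i.succ 0 = 0 := fun i => by
    simp only [B, c, Matrix.gram_apply, Fin.cons_succ, Fin.cons_zero, ← hp]
    rw [div_mul_cancel₀ _ hpp, sub_self]
  have hdet : orthogonalGramDet V (Fin.cons u U : Fin (k + 1) → E) = B.det := by
    refine Matrix.det_eq_of_forall_row_eq_smul_add_const c 0 rfl fun i j => ?_
    simp only [B, c, Matrix.gram_apply, Fin.cons_zero, zero_mul, sub_zero, ← hp]
    ring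
  rw [hdet, Matrix.det_succ_column_zero, Fin.sum_univ_succ]
  simp only [hB0, mul_zero, zero_mul, Finset.sum_const_zero, add_zero, Fin.val_zero, pow_zero,
    one_mul]
  have h00 : B 0 0 = ‖p‖ ^ 2 := by
    change inner ℝ p p - 0 * inner ℝ p p = ‖p‖ ^ 2
    rw [zero_mul, sub_zero, real_inner_self_eq_norm_sq]
  rw [h00, orthogonalGramDet]
  congr 2
  ext i j
  change inner ℝ (Vᗮ.starProjection (U i)) (Vᗮ.starProjection (U j)) -
    inner ℝ (Vᗮ.starProjection (U i)) p / inner ℝ p p * inner ℝ p (Vᗮ.starProjection (U j)) =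
    inner ℝ ((V ⊔ Submodule.span ℝ {u})ᗮ.starProjection (U i))
      ((V ⊔ Submodule.span ℝ {u})ᗮ.starProjection (U j))
  rw [starProjection_orthogonal_sup_span_singleton V u _ hu,
    starProjection_orthogonal_sup_span_singleton V u _ hu, ← hp]
  simp only [inner_sub_left, inner_sub_right, real_inner_smul_left, real_inner_smul_right]
  rw [real_inner_comm p (Vᗮ.starProjection (U j))]
  field_simp
  ring

variable [MeasurableSpace E] [BorelSpace E]

lemma measurable_orthogonalGramDet (V : Submodule ℝ E) {k : ℕ} :
    Measurable (orthogonalGramDet V : (Fin k → E) → ℝ) := by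
  have : Continuous (orthogonalGramDet V : (Fin k → E) → ℝ) := by
    refine Continuous.matrix_det (continuous_matrix fun i j => ?_)
    simp only [Matrix.gram_apply]
    fun_prop
  exact this.measurable

/-- The moment of order `s` of the chi-squared distribution with `r` degrees of freedom. -/
noncomputable def chiSquaredMoment (r s : ℝ) : ℝ :=
  2 ^ s * Real.Gamma (r / 2 + s) / Real.Gamma (r / 2)

/-- Induction on `k` for all `V` at once: conditionally on the first vector, which almost surely
lies outside `V`, the remaining ones face a subspace of one more dimension. The bound on `s` covers
the worst case of one degree of freedom. -/
lemma lintegral_orthogonalGramDet_rpow {s : ℝ} (hs : -(1 / 2) < s) (k : ℕ) :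
    ∀ V : Submodule ℝ E, Module.finrank ℝ V + k ≤ Module.finrank ℝ E →
    ∫⁻ U, ENNReal.ofReal (orthogonalGramDet V U) ^ s
        ∂(Measure.pi fun _ : Fin k => stdGaussian E) =
      ∏ j ∈ Finset.range k, ENNReal.ofReal (chiSquaredMoment
        ((Module.finrank ℝ E : ℝ) - Module.finrank ℝ V - j) s) := by
  induction k with
  | zero => intro V _; simp [orthogonalGramDet]
  | succ k ih =>
    intro V hV
    have hVtop : V ≠ ⊤ := by
      rintro rfl
      rw [finrank_top] at hV
      omega
    have hdim : Module.finrank ℝ V + Module.finrank ℝ Vᗮ = Module.finrank ℝ E :=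
      V.finrank_add_finrank_orthogonal
    have hdim' : (Module.finrank ℝ Vᗮ : ℝ) = Module.finrank ℝ E - Module.finrank ℝ V := by
      rw [← hdim]; push_cast; ring
    have hdim1 : 1 ≤ Module.finrank ℝ Vᗮ := by omega
    have hdim1' : (1 : ℝ) ≤ Module.finrank ℝ Vᗮ := by exact_mod_cast hdim1
    have hnot : ∀ᵐ u ∂(stdGaussian E), u ∉ V :=
      stdGaussian_absolutelyContinuous (measure_eq_zero_iff_ae_notMem.1
        (Measure.addHaar_submodule volume V hVtop))
    have hmeas : Measurable fun U : Fin (k + 1) → E =>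
        ENNReal.ofReal (orthogonalGramDet V U) ^ s :=
      (measurable_orthogonalGramDet V).ennreal_ofReal.pow_const s
    have hmp := (measurePreserving_piFinSuccAbove (fun _ : Fin (k + 1) => stdGaussian E) 0).symm
    have hmeas' : Measurable fun z : E × (Fin k → E) => ENNReal.ofReal (orthogonalGramDet V
        ((MeasurableEquiv.piFinSuccAbove (fun _ : Fin (k + 1) => E) 0).symm z)) ^ s :=
      hmeas.comp (MeasurableEquiv.measurable _)
    rw [← hmp.lintegral_comp hmeas, lintegral_prod _ hmeas'.aemeasurable]
    have hinner : ∀ᵐ u ∂(stdGaussian E),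
        ∫⁻ U, ENNReal.ofReal (orthogonalGramDet V
          ((MeasurableEquiv.piFinSuccAbove (fun _ : Fin (k + 1) => E) 0).symm (u, U))) ^ s
          ∂(Measure.pi fun _ : Fin k => stdGaussian E) =
        ENNReal.ofReal (‖Vᗮ.starProjection u‖ ^ 2) ^ s *
          ∏ j ∈ Finset.range k, ENNReal.ofReal (chiSquaredMoment
            ((Module.finrank ℝ E : ℝ) - Module.finrank ℝ V - (j + 1 : ℕ)) s) := by
      filter_upwards [hnot] with u hu
      have e : ∀ U : Fin k → E, (MeasurableEquiv.piFinSuccAbove (fun _ : Fin (k + 1) => E) 0).symm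
          (u, U) = (Fin.cons u U : Fin (k + 1) → E) := fun U => by
        simp [MeasurableEquiv.piFinSuccAbove, Fin.insertNthEquiv]
      simp_rw [e, orthogonalGramDet_cons, ENNReal.ofReal_mul (sq_nonneg _),
        ENNReal.mul_rpow_of_ne_top ENNReal.ofReal_ne_top ENNReal.ofReal_ne_top]
      rw [lintegral_const_mul _ ((measurable_orthogonalGramDet _).ennreal_ofReal.pow_const s),
        ih _ (by rw [Submodule.finrank_sup_span_singleton hu]; omega), Submodule.finrank_sup_span_singleton hu]
      congr 1
      refine Finset.prod_congr rfl fun j _ => ?_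
      push_cast
      ring_nf
    rw [lintegral_congr_ae hinner, lintegral_mul_const _ (by fun_prop),
      lintegral_norm_sq_starProjection_rpow_stdGaussian Vᗮ hdim1 (by linarith), hdim',
      Finset.prod_range_succ', mul_comm]
    simp [chiSquaredMoment]

lemma chiSquaredMoment_pos {r s : ℝ} (hr : 0 < r) (hs : 0 < r / 2 + s) :
    0 < chiSquaredMoment r s := by
  have h1 := Real.Gamma_pos_of_pos hs
  have h2 := Real.Gamma_pos_of_pos (half_pos hr)
  unfold chiSquaredMoment
  positivity

lemma hasDerivAt_log_chiSquaredMoment {r : ℝ} (hr : 0 < r) :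
    HasDerivAt (fun s => Real.log (chiSquaredMoment r s)) (Real.log 2 + realDigamma (r / 2)) 0 := by
  have h1 : HasDerivAt (fun s : ℝ => s * Real.log 2 + Real.log (Real.Gamma (r / 2 + s)) -
      Real.log (Real.Gamma (r / 2))) (Real.log 2 + realDigamma (r / 2)) 0 := by
    have ha : HasDerivAt (fun s : ℝ => s * Real.log 2) (Real.log 2) 0 := by
      simpa using (hasDerivAt_id (0 : ℝ)).mul_const (Real.log 2)
    have hb : HasDerivAt (fun s : ℝ => Real.log (Real.Gamma (r / 2 + s)))
        (realDigamma (r / 2)) 0 := by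
      have hc : HasDerivAt (fun t : ℝ => Real.log (Real.Gamma t)) (realDigamma (r / 2))
          (r / 2 + 0) := by
        rw [add_zero]
        exact hasDerivAt_log_Gamma (half_pos hr)
      exact hc.comp_const_add (r / 2) 0
    exact (ha.add hb).sub_const _
  refine h1.congr_of_eventuallyEq ?_
  filter_upwards [lt_mem_nhds (show -(r / 2) < 0 by linarith)] with s hs
  have hg1 := Real.Gamma_pos_of_pos (show 0 < r / 2 + s by linarith)
  have hg2 := Real.Gamma_pos_of_pos (half_pos hr)
  rw [chiSquaredMoment, Real.log_div (by positivity) hg2.ne', Real.log_mul (by positivity) hg1.ne',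
    Real.log_rpow two_pos]

variable {k : ℕ} {V : Submodule ℝ E}

/-- A finite moment of negative order forces positivity, since zero to a negative power is `∞`. Any
order in `(-1/2, 0)` would serve. -/
lemma ae_orthogonalGramDet_pos (hV : Module.finrank ℝ V + k ≤ Module.finrank ℝ E) :
    ∀ᵐ U ∂(Measure.pi fun _ : Fin k => stdGaussian E), 0 < orthogonalGramDet V U := by
  have h := lintegral_orthogonalGramDet_rpow (s := -(1 / 4)) (by norm_num) k V hV
  have hfin : ∫⁻ U, ENNReal.ofReal (orthogonalGramDet V U) ^ (-(1 / 4) : ℝ)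
      ∂(Measure.pi fun _ : Fin k => stdGaussian E) ≠ ∞ := by
    rw [h]
    exact ENNReal.prod_ne_top fun _ _ => ENNReal.ofReal_ne_top
  filter_upwards [ae_lt_top ((measurable_orthogonalGramDet V).ennreal_ofReal.pow_const _) hfin]
    with U hU
  refine (orthogonalGramDet_nonneg V U).lt_of_ne' fun h0 => ?_
  rw [h0, ENNReal.ofReal_zero, ENNReal.zero_rpow_of_neg (by norm_num)] at hU
  exact lt_irrefl _ hU

lemma integrable_exp_mul_log_orthogonalGramDet
    (hV : Module.finrank ℝ V + k ≤ Module.finrank ℝ E) {s : ℝ} (hs : -(1 / 2) < s) :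
    Integrable (fun U => Real.exp (s * Real.log (orthogonalGramDet V U)))
      (Measure.pi fun _ : Fin k => stdGaussian E) ∧
    ∫ U, Real.exp (s * Real.log (orthogonalGramDet V U))
      ∂(Measure.pi fun _ : Fin k => stdGaussian E) =
      ∏ j ∈ Finset.range k, chiSquaredMoment
        ((Module.finrank ℝ E : ℝ) - Module.finrank ℝ V - j) s := by
  have hV' : (Module.finrank ℝ V : ℝ) + k ≤ Module.finrank ℝ E := by exact_mod_cast hV
  have h := lintegral_orthogonalGramDet_rpow hs k V hV
  have hmeas : Measurable fun U : Fin k → E => Real.exp (s * Real.log (orthogonalGramDet V U)) :=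
    ((measurable_orthogonalGramDet V).log.const_mul s).exp
  have hcongr : ∫⁻ U, ENNReal.ofReal (Real.exp (s * Real.log (orthogonalGramDet V U)))
      ∂(Measure.pi fun _ : Fin k => stdGaussian E) =
      ENNReal.ofReal (∏ j ∈ Finset.range k, chiSquaredMoment
        ((Module.finrank ℝ E : ℝ) - Module.finrank ℝ V - j) s) := by
    rw [ENNReal.ofReal_prod_of_nonneg, ← h]
    · refine lintegral_congr_ae ?_
      filter_upwards [ae_orthogonalGramDet_pos hV] with U hU
      rw [ENNReal.ofReal_rpow_of_pos hU, Real.rpow_def_of_pos hU, mul_comm]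
    · intro j hj
      have hj' : (j : ℝ) + 1 ≤ k := by exact_mod_cast Finset.mem_range.1 hj
      exact (chiSquaredMoment_pos (by linarith) (by linarith)).le
  have hprod : 0 ≤ ∏ j ∈ Finset.range k, chiSquaredMoment
        ((Module.finrank ℝ E : ℝ) - Module.finrank ℝ V - j) s := by
    refine Finset.prod_nonneg fun j hj => ?_
    have hj' : (j : ℝ) + 1 ≤ k := by exact_mod_cast Finset.mem_range.1 hj
    exact (chiSquaredMoment_pos (by linarith) (by linarith)).le
  constructor
  · refine (lintegral_ofReal_ne_top_iff_integrable hmeas.aestronglyMeasurable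
      (ae_of_all _ fun _ => (Real.exp_pos _).le)).1 ?_
    rw [hcongr]
    exact ENNReal.ofReal_ne_top
  · rw [integral_eq_lintegral_of_nonneg_ae (ae_of_all _ fun _ => (Real.exp_pos _).le)
      hmeas.aestronglyMeasurable, hcongr, ENNReal.toReal_ofReal hprod]

lemma integrable_log_orthogonalGramDet (hV : Module.finrank ℝ V + k ≤ Module.finrank ℝ E) :
    Integrable (fun U => Real.log (orthogonalGramDet V U))
      (Measure.pi fun _ : Fin k => stdGaussian E) := by
  -- Exponential moments of both signs, here `±1/4`, bound every power of the logarithm.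
  simpa using integrable_pow_of_integrable_exp_mul (t := 1 / 4) (by norm_num)
    (integrable_exp_mul_log_orthogonalGramDet hV (s := 1 / 4) (by norm_num)).1
    (integrable_exp_mul_log_orthogonalGramDet hV (s := -(1 / 4)) (by norm_num)).1 1

/-- The mean is the derivative at zero of the cumulant generating function of the logarithm, which
is a sum of logarithms of chi-squared moments. -/
lemma integral_log_orthogonalGramDet (hV : Module.finrank ℝ V + k ≤ Module.finrank ℝ E) :
    ∫ U, Real.log (orthogonalGramDet V U) ∂(Measure.pi fun _ : Fin k => stdGaussian E) =
      ∑ j ∈ Finset.range k, (Real.log 2 +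
        realDigamma (((Module.finrank ℝ E : ℝ) - Module.finrank ℝ V - j) / 2)) := by
  have hV' : (Module.finrank ℝ V : ℝ) + k ≤ Module.finrank ℝ E := by exact_mod_cast hV
  have hsub : Set.Ioi (-(1 / 2) : ℝ) ⊆ integrableExpSet
      (fun U => Real.log (orthogonalGramDet V U)) (Measure.pi fun _ : Fin k => stdGaussian E) :=
    fun s hs => (integrable_exp_mul_log_orthogonalGramDet hV hs).1
  have hint : (0 : ℝ) ∈ interior (integrableExpSet
      (fun U => Real.log (orthogonalGramDet V U))
      (Measure.pi fun _ : Fin k => stdGaussian E)) :=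
    interior_maximal hsub isOpen_Ioi (by simp)
  have h := deriv_cgf_zero hint
  rw [probReal_univ, div_one] at h
  rw [← h]
  refine HasDerivAt.deriv ?_
  have hsum : HasDerivAt (fun s => ∑ j ∈ Finset.range k, Real.log (chiSquaredMoment
        ((Module.finrank ℝ E : ℝ) - Module.finrank ℝ V - j) s))
      (∑ j ∈ Finset.range k, (Real.log 2 +
        realDigamma (((Module.finrank ℝ E : ℝ) - Module.finrank ℝ V - j) / 2))) 0 := by
    refine HasDerivAt.fun_sum fun j hj => hasDerivAt_log_chiSquaredMoment ?_
    have hj' : (j : ℝ) + 1 ≤ k := by exact_mod_cast Finset.mem_range.1 hj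
    linarith
  refine hsum.congr_of_eventuallyEq ?_
  filter_upwards [lt_mem_nhds (show (-(1 / 2) : ℝ) < 0 by norm_num)] with s hs
  rw [cgf, mgf, (integrable_exp_mul_log_orthogonalGramDet hV hs).2, Real.log_prod]
  intro j hj
  have hj' : (j : ℝ) + 1 ≤ k := by exact_mod_cast Finset.mem_range.1 hj
  exact (chiSquaredMoment_pos (by linarith) (by linarith)).ne'

end Gram

/-! ### Kullback-Leibler divergence of affine images of the standard Gaussian. -/

/-- The data-processing inequality, applied to the bijection and to its inverse. -/
lemma klDiv_map_measurableEquiv {α β : Type*} [MeasurableSpace α] [MeasurableSpace β]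
    (e : α ≃ᵐ β) (μ ν : Measure α) [IsFiniteMeasure μ] [IsFiniteMeasure ν] :
    klDiv (μ.map e) (ν.map e) = klDiv μ ν := by
  refine le_antisymm (klDiv_map_le _ _ e.measurable) ?_
  have h := klDiv_map_le (μ.map e) (ν.map e) e.symm.measurable
  rwa [e.map_symm_map, e.map_symm_map] at h

section AffineImage

variable {E : Type*} [NormedAddCommGroup E] [InnerProductSpace ℝ E]
  [MeasurableSpace E] [BorelSpace E]

/-- The affine bijection `x ↦ m + L x` as a measurable equivalence. -/
noncomputable def affineMeasurableEquiv (L : E ≃L[ℝ] E) (m : E) : E ≃ᵐ E :=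
  (L.toHomeomorph.trans (Homeomorph.addLeft m)).toMeasurableEquiv

@[simp]
lemma affineMeasurableEquiv_apply (L : E ≃L[ℝ] E) (m x : E) :
    affineMeasurableEquiv L m x = m + L x := rfl

/-- The density of the image of the standard Gaussian distribution under `x ↦ m + L x` with respect
to the standard Gaussian distribution. -/
noncomputable def affineDensity (L : E ≃L[ℝ] E) (m x : E) : ℝ :=
  |(LinearMap.det (L : E →ₗ[ℝ] E))⁻¹| *
    (stdGaussianPDF ((affineMeasurableEquiv L m).symm x) / stdGaussianPDF x)

lemma measurable_affineDensity (L : E ≃L[ℝ] E) (m : E) : Measurable (affineDensity L m) :=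
  ((measurable_stdGaussianPDF.comp (MeasurableEquiv.measurable _)).div
    measurable_stdGaussianPDF).const_mul _

lemma affineDensity_pos (L : E ≃L[ℝ] E) (m x : E) : 0 < affineDensity L m x := by
  have hdet : LinearMap.det (L : E →ₗ[ℝ] E) ≠ 0 :=
    (LinearEquiv.isUnit_det' L.toLinearEquiv).ne_zero
  exact mul_pos (abs_pos.2 (inv_ne_zero hdet))
    (div_pos (stdGaussianPDF_pos _) (stdGaussianPDF_pos _))

lemma log_affineDensity (L : E ≃L[ℝ] E) (m z : E) :
    Real.log (affineDensity L m (m + L z)) =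
      1 / 2 * ‖m + L z‖ ^ 2 - 1 / 2 * ‖z‖ ^ 2 - Real.log |LinearMap.det (L : E →ₗ[ℝ] E)| := by
  have hdet : LinearMap.det (L : E →ₗ[ℝ] E) ≠ 0 :=
    (LinearEquiv.isUnit_det' L.toLinearEquiv).ne_zero
  have hsymm : (affineMeasurableEquiv L m).symm (m + L z) = z := by
    rw [← affineMeasurableEquiv_apply, MeasurableEquiv.symm_apply_apply]
  have hC : (0 : ℝ) < ((Real.pi / (1 / 2)) ^ (Module.finrank ℝ E / 2 : ℝ))⁻¹ := by positivity
  rw [affineDensity, hsymm, Real.log_mul (abs_pos.2 (inv_ne_zero hdet)).ne'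
    (div_pos (stdGaussianPDF_pos _) (stdGaussianPDF_pos _)).ne',
    Real.log_div (stdGaussianPDF_pos _).ne' (stdGaussianPDF_pos _).ne', abs_inv, Real.log_inv,
    stdGaussianPDF, stdGaussianPDF, Real.log_mul hC.ne' (Real.exp_pos _).ne',
    Real.log_mul hC.ne' (Real.exp_pos _).ne', Real.log_exp, Real.log_exp]
  ring

variable [FiniteDimensional ℝ E]

lemma lintegral_comp_affineMeasurableEquiv (L : E ≃L[ℝ] E) (m : E) (f : E → ℝ≥0∞) :
    ∫⁻ x, f (affineMeasurableEquiv L m x) =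
      ENNReal.ofReal |(LinearMap.det (L : E →ₗ[ℝ] E))⁻¹| * ∫⁻ x, f x := by
  have hdet : LinearMap.det (L : E →ₗ[ℝ] E) ≠ 0 :=
    (LinearEquiv.isUnit_det' L.toLinearEquiv).ne_zero
  have h := Measure.map_linearMap_addHaar_eq_smul_addHaar (volume : Measure E) hdet
  have h1 : ∫⁻ x, f (m + L x) = ∫⁻ x, f (m + x) ∂(volume.map (L : E →ₗ[ℝ] E)) :=
    (lintegral_map_equiv (fun x => f (m + x)) L.toHomeomorph.toMeasurableEquiv).symm
  simp only [affineMeasurableEquiv_apply]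
  rw [h1, h, lintegral_smul_measure, lintegral_add_left_eq_self, smul_eq_mul]

lemma map_affine_stdGaussian_eq_withDensity (L : E ≃L[ℝ] E) (m : E) :
    (stdGaussian E).map (affineMeasurableEquiv L m) =
      (stdGaussian E).withDensity fun x => ENNReal.ofReal (affineDensity L m x) := by
  ext s hs
  rw [← lintegral_indicator_one hs, lintegral_map_equiv, lintegral_stdGaussian,
    withDensity_apply _ hs, ← lintegral_indicator hs, lintegral_stdGaussian]
  have h := lintegral_comp_affineMeasurableEquiv L m fun x =>
    ENNReal.ofReal (stdGaussianPDF ((affineMeasurableEquiv L m).symm x)) * s.indicator 1 x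
  simp only [MeasurableEquiv.symm_apply_apply] at h
  rw [h, ← lintegral_const_mul' _ _ ENNReal.ofReal_ne_top]
  refine lintegral_congr fun x => ?_
  by_cases hx : x ∈ s
  · rw [Set.indicator_of_mem hx, Set.indicator_of_mem hx, Pi.one_apply, mul_one,
      ← ENNReal.ofReal_mul (abs_nonneg _), ← ENNReal.ofReal_mul (stdGaussianPDF_pos x).le,
      affineDensity]
    congr 1
    field_simp [(stdGaussianPDF_pos x).ne']
  · rw [Set.indicator_of_notMem hx, Set.indicator_of_notMem hx]
    simp

/-- The Kullback-Leibler divergence of a nondegenerate Gaussian distribution from the standard one,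
as an integral. -/
lemma klDiv_map_affine_stdGaussian (L : E ≃L[ℝ] E) (m : E)
    (hint : Integrable (fun z => 1 / 2 * ‖m + L z‖ ^ 2 - 1 / 2 * ‖z‖ ^ 2 -
      Real.log |LinearMap.det (L : E →ₗ[ℝ] E)|) (stdGaussian E)) :
    klDiv ((stdGaussian E).map (affineMeasurableEquiv L m)) (stdGaussian E) =
      ENNReal.ofReal (∫ z, (1 / 2 * ‖m + L z‖ ^ 2 - 1 / 2 * ‖z‖ ^ 2 -
        Real.log |LinearMap.det (L : E →ₗ[ℝ] E)|) ∂(stdGaussian E)) ∧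
    0 ≤ ∫ z, (1 / 2 * ‖m + L z‖ ^ 2 - 1 / 2 * ‖z‖ ^ 2 -
        Real.log |LinearMap.det (L : E →ₗ[ℝ] E)|) ∂(stdGaussian E) := by
  set ν := (stdGaussian E).map (affineMeasurableEquiv L m) with hν
  have : IsProbabilityMeasure ν :=
    Measure.isProbabilityMeasure_map (MeasurableEquiv.measurable _).aemeasurable
  have hac : ν ≪ stdGaussian E := by
    rw [hν, map_affine_stdGaussian_eq_withDensity]
    exact withDensity_absolutelyContinuous _ _
  have hllr : llr ν (stdGaussian E) =ᵐ[ν] fun x => Real.log (affineDensity L m x) := by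
    refine hac ?_
    have h := Measure.rnDeriv_withDensity (stdGaussian E)
      (measurable_affineDensity L m).ennreal_ofReal
    rw [← map_affine_stdGaussian_eq_withDensity, ← hν] at h
    filter_upwards [h] with x hx
    rw [llr, hx, ENNReal.toReal_ofReal (affineDensity_pos L m x).le]
  have hint' : Integrable (llr ν (stdGaussian E)) ν := by
    rw [integrable_congr hllr, hν, integrable_map_equiv]
    simpa only [Function.comp_def, affineMeasurableEquiv_apply, log_affineDensity] using hint
  have hval : ∫ x, llr ν (stdGaussian E) x ∂ν = ∫ z, (1 / 2 * ‖m + L z‖ ^ 2 - 1 / 2 * ‖z‖ ^ 2 -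
        Real.log |LinearMap.det (L : E →ₗ[ℝ] E)|) ∂(stdGaussian E) := by
    rw [integral_congr_ae hllr, hν, integral_map_equiv]
    simp only [affineMeasurableEquiv_apply, log_affineDensity]
  have h1 := klDiv_of_ac_of_integrable hac hint'
  have h2 := integral_llr_add_sub_measure_univ_nonneg hac hint'
  -- Both measures have mass one, so the mass correction in `klDiv` cancels.
  simp only [probReal_univ, add_sub_cancel_right, hval] at h1 h2
  exact ⟨h1, h2⟩

lemma integrable_and_integral_add_inner_sq_stdGaussian (c : ℝ) (a : E) :
    Integrable (fun z => (c + inner ℝ a z) ^ 2) (stdGaussian E) ∧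
    ∫ z, (c + inner ℝ a z) ^ 2 ∂(stdGaussian E) = c ^ 2 + ‖a‖ ^ 2 := by
  have hL2 : MemLp (fun z => inner ℝ a z) 2 (stdGaussian E) :=
    (innerSL ℝ a).comp_memLp' IsGaussian.memLp_two_id
  have hi1 : Integrable (fun z => inner ℝ a z) (stdGaussian E) := hL2.integrable one_le_two
  have hi2 : Integrable (fun z => inner ℝ a z ^ 2) (stdGaussian E) := hL2.integrable_sq
  have hmean : ∫ z, inner ℝ a z ∂(stdGaussian E) = 0 :=
    integral_strongDual_stdGaussian (innerSL ℝ a)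
  have hvar : ∫ z, inner ℝ a z ^ 2 ∂(stdGaussian E) = ‖a‖ ^ 2 := by
    have h := variance_dual_stdGaussian (innerSL ℝ a)
    rw [variance_eq_sub (by exact hL2), innerSL_apply_norm, integral_strongDual_stdGaussian] at h
    simpa using h
  have e : (fun z => (c + inner ℝ a z) ^ 2) =
      fun z => (c ^ 2 + 2 * c * inner ℝ a z) + inner ℝ a z ^ 2 := by
    ext z; ring
  have hi3 : Integrable (fun z => c ^ 2 + 2 * c * inner ℝ a z) (stdGaussian E) :=
    (integrable_const _).add (hi1.const_mul _)
  rw [e]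
  refine ⟨hi3.add hi2, ?_⟩
  rw [integral_add hi3 hi2, integral_add (integrable_const _) (hi1.const_mul _),
    integral_const_mul, hmean, hvar]
  simp

end AffineImage

/-! ### Multivariate Gaussians: explicit divergence, degeneracy, affine maps. -/

section Matrix

open Matrix
open scoped MatrixOrder

variable {d : ℕ}

lemma exists_continuousLinearEquiv_of_det_ne_zero {B : Matrix (Fin d) (Fin d) ℝ}
    (hB : B.det ≠ 0) :
    ∃ L : EuclideanSpace ℝ (Fin d) ≃L[ℝ] EuclideanSpace ℝ (Fin d),
      (∀ x, L x = toEuclideanCLM (𝕜 := ℝ) B x) ∧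
      LinearMap.det (L : EuclideanSpace ℝ (Fin d) →ₗ[ℝ] EuclideanSpace ℝ (Fin d)) = B.det := by
  have hdet : LinearMap.det (toEuclideanLin B) = B.det := by
    change LinearMap.det (toLpLin 2 2 B) = B.det
    rw [toLpLin_eq_toLin, LinearMap.det_toLin]
  have hne : LinearMap.det (toEuclideanLin B) ≠ 0 := hdet ▸ hB
  exact ⟨(LinearMap.equivOfDetNeZero _ hne).toContinuousLinearEquiv, fun x => rfl, hdet⟩

/-- Each coordinate is a constant plus the pairing of `z` with a row of `B`, so the second moments
add up to the squared row norms. -/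
lemma integrable_and_integral_norm_sq_add_toEuclideanCLM (m : EuclideanSpace ℝ (Fin d))
    (B : Matrix (Fin d) (Fin d) ℝ) :
    Integrable (fun z => ‖m + toEuclideanCLM (𝕜 := ℝ) B z‖ ^ 2)
      (stdGaussian (EuclideanSpace ℝ (Fin d))) ∧
    ∫ z, ‖m + toEuclideanCLM (𝕜 := ℝ) B z‖ ^ 2 ∂(stdGaussian (EuclideanSpace ℝ (Fin d))) =
      ‖m‖ ^ 2 + (B * Bᵀ).trace := by
  have e : (fun z : EuclideanSpace ℝ (Fin d) => ‖m + toEuclideanCLM (𝕜 := ℝ) B z‖ ^ 2) =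
      fun z => ∑ i, (m i + inner ℝ (WithLp.toLp 2 (B i) : EuclideanSpace ℝ (Fin d)) z) ^ 2 := by
    ext z
    rw [EuclideanSpace.real_norm_sq_eq]
    refine Finset.sum_congr rfl fun i _ => ?_
    rw [PiLp.add_apply, ofLp_toEuclideanCLM]
    simp [PiLp.inner_apply, mulVec, dotProduct, mul_comm]
  have h i := integrable_and_integral_add_inner_sq_stdGaussian (m i)
    (WithLp.toLp 2 (B i) : EuclideanSpace ℝ (Fin d))
  rw [e]
  refine ⟨integrable_finsetSum _ fun i _ => (h i).1, ?_⟩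
  rw [integral_finsetSum _ fun i _ => (h i).1]
  rw [Finset.sum_congr rfl fun i _ => (h i).2, Finset.sum_add_distrib,
    EuclideanSpace.real_norm_sq_eq]
  refine congrArg₂ _ rfl (Finset.sum_congr rfl fun i _ => ?_)
  refine (EuclideanSpace.real_norm_sq_eq _).trans ?_
  simp only [Matrix.diag, Matrix.mul_apply, Matrix.transpose_apply, sq]

lemma sqrt_mul_transpose_sqrt {T : Matrix (Fin d) (Fin d) ℝ} (hT : T.PosSemidef) :
    CFC.sqrt T * (CFC.sqrt T)ᵀ = T := by
  have h : (CFC.sqrt T)ᵀ = CFC.sqrt T := (CFC.sqrt_nonneg T).posSemidef.isHermitian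
  rw [h, CFC.sqrt_mul_sqrt_self _ hT.nonneg]

lemma det_sqrt_sq {T : Matrix (Fin d) (Fin d) ℝ} (hT : T.PosSemidef) :
    (CFC.sqrt T).det ^ 2 = T.det := by
  rw [sq, ← Matrix.det_mul, CFC.sqrt_mul_sqrt_self _ hT.nonneg]

lemma det_sqrt_ne_zero {T : Matrix (Fin d) (Fin d) ℝ} (hT : T.PosDef) :
    (CFC.sqrt T).det ≠ 0 := by
  intro h
  have := det_sqrt_sq hT.posSemidef
  rw [h] at this
  exact hT.det_pos.ne' (by simpa using this.symm)

/-- The Kullback-Leibler divergence of a nondegenerate multivariate Gaussian distribution from the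
standard one. -/
lemma klDiv_multivariateGaussian_stdGaussian (m : EuclideanSpace ℝ (Fin d))
    {T : Matrix (Fin d) (Fin d) ℝ} (hT : T.PosDef) :
    klDiv (multivariateGaussian m T) (stdGaussian (EuclideanSpace ℝ (Fin d))) =
      ENNReal.ofReal (1 / 2 * (T.trace + ‖m‖ ^ 2 - d - Real.log T.det)) ∧
    0 ≤ 1 / 2 * (T.trace + ‖m‖ ^ 2 - d - Real.log T.det) := by
  obtain ⟨L, hL, hdet⟩ := exists_continuousLinearEquiv_of_det_ne_zero (det_sqrt_ne_zero hT)
  have hG : multivariateGaussian m T =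
      (stdGaussian (EuclideanSpace ℝ (Fin d))).map (affineMeasurableEquiv L m) := by
    rw [multivariateGaussian]
    congr 1
    ext1 x
    rw [affineMeasurableEquiv_apply, hL]
  obtain ⟨hi1, hv1⟩ := integrable_and_integral_norm_sq_add_toEuclideanCLM m (CFC.sqrt T)
  obtain ⟨hi2, hv2⟩ := integrable_and_integral_norm_sq_add_toEuclideanCLM
    (0 : EuclideanSpace ℝ (Fin d)) 1
  simp only [← hL, sqrt_mul_transpose_sqrt hT.posSemidef] at hi1 hv1
  simp only [map_one, zero_add, one_apply_eq_self, norm_zero, transpose_one, mul_one,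
    trace_one, Fintype.card_fin, ne_eq, OfNat.ofNat_ne_zero, not_false_eq_true, zero_pow]
    at hi2 hv2
  have hi3 := (hi1.const_mul (1 / 2)).sub (hi2.const_mul (1 / 2))
  have hint := hi3.sub (integrable_const (Real.log |(CFC.sqrt T).det|))
  have hlog : Real.log |(CFC.sqrt T).det| = 1 / 2 * Real.log T.det := by
    rw [← det_sqrt_sq hT.posSemidef, Real.log_pow, Real.log_abs]
    push_cast
    ring
  have h := klDiv_map_affine_stdGaussian L m (by rw [hdet]; exact hint)
  have hval : ∫ z, (1 / 2 * ‖m + L z‖ ^ 2 - 1 / 2 * ‖z‖ ^ 2 - Real.log |(CFC.sqrt T).det|)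
      ∂(stdGaussian (EuclideanSpace ℝ (Fin d))) =
      1 / 2 * (T.trace + ‖m‖ ^ 2 - d - Real.log T.det) := by
    rw [integral_sub (by exact hi3) (integrable_const _), integral_sub (hi1.const_mul _)
      (hi2.const_mul _), integral_const_mul, integral_const_mul, hv1, hv2, integral_const, hlog]
    simp only [probReal_univ, one_smul]
    ring
  rw [hdet, hval, ← hG] at h
  exact h

/-- The marginal along `v` is a real Gaussian of positive variance, hence has no atoms. -/
lemma multivariateGaussian_hyperplane_eq_zero (m : EuclideanSpace ℝ (Fin d))
    {S : Matrix (Fin d) (Fin d) ℝ} (hS : S.PosDef) {v : EuclideanSpace ℝ (Fin d)} (hv : v ≠ 0)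
    (c : ℝ) : multivariateGaussian m S {x | inner ℝ v x = c} = 0 := by
  have hmap := IsGaussian.map_eq_gaussianReal (μ := multivariateGaussian m S) (innerSL ℝ v)
  have hvar : 0 < Var[innerSL ℝ v; multivariateGaussian m S] := by
    have h1 : Var[innerSL ℝ v; multivariateGaussian m S] =
        covarianceBilin (multivariateGaussian m S) v v :=
      (covarianceBilin_self IsGaussian.memLp_two_id v).symm
    rw [h1, covarianceBilin_multivariateGaussian hS.posSemidef]
    exact hS.dotProduct_mulVec_pos (x := v.ofLp) (by simpa using hv)
  have : NullSingletonClass ((multivariateGaussian m S).map (innerSL ℝ v)) := by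
    rw [hmap]
    exact nullSingletonClass_gaussianReal (by simpa using hvar)
  have h : (multivariateGaussian m S).map (innerSL ℝ v) {c} = 0 := measure_singleton _
  rwa [Measure.map_apply (by fun_prop) (measurableSet_singleton c)] at h

/-- Zero variance along `v` puts the first law on a single hyperplane, which the second law does not
charge. -/
lemma klDiv_multivariateGaussian_eq_top (m μ : EuclideanSpace ℝ (Fin d))
    {S T : Matrix (Fin d) (Fin d) ℝ} (hS : S.PosDef) (hT : T.PosSemidef)
    {v : EuclideanSpace ℝ (Fin d)} (hv : v ≠ 0) (hTv : v.ofLp ⬝ᵥ T *ᵥ v.ofLp = 0) :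
    klDiv (multivariateGaussian m T) (multivariateGaussian μ S) = ∞ := by
  refine klDiv_of_not_ac fun hac => ?_
  have h0 := hac (multivariateGaussian_hyperplane_eq_zero μ hS hv (inner ℝ v m))
  have hvar : Var[innerSL ℝ v; multivariateGaussian m T] = 0 := by
    have h1 : Var[innerSL ℝ v; multivariateGaussian m T] =
        covarianceBilin (multivariateGaussian m T) v v :=
      (covarianceBilin_self IsGaussian.memLp_two_id v).symm
    rw [h1, covarianceBilin_multivariateGaussian hT, hTv]
  have hmap := IsGaussian.map_eq_gaussianReal (μ := multivariateGaussian m T) (innerSL ℝ v)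
  have hmean : (multivariateGaussian m T)[innerSL ℝ v] = inner ℝ v m := by
    rw [(innerSL ℝ v).integral_comp_id_comm IsGaussian.integrable_id,
      integral_id_multivariateGaussian]
    rfl
  rw [hvar, hmean, Real.toNNReal_zero, gaussianReal_zero_var] at hmap
  have h1 : (multivariateGaussian m T).map (innerSL ℝ v) {inner ℝ v m} = 1 := by
    rw [hmap]; simp
  rw [Measure.map_apply (by fun_prop) (measurableSet_singleton _)] at h1
  exact zero_ne_one (h0.symm.trans h1)

/-- Characteristic functions are compared because `A * CFC.sqrt T` need not be the positive square
root of `A * T * Aᵀ`. -/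
lemma map_affine_multivariateGaussian (m μ : EuclideanSpace ℝ (Fin d))
    {A T : Matrix (Fin d) (Fin d) ℝ} (hT : T.PosSemidef)
    {L : EuclideanSpace ℝ (Fin d) ≃L[ℝ] EuclideanSpace ℝ (Fin d)}
    (hL : ∀ x, L x = toEuclideanCLM (𝕜 := ℝ) A x) :
    (multivariateGaussian m T).map (affineMeasurableEquiv L μ) =
      multivariateGaussian (μ + L m) (A * T * Aᵀ) := by
  have hT' : (A * T * Aᵀ).PosSemidef := by
    simpa using hT.mul_mul_conjTranspose_same A
  have : IsProbabilityMeasure ((multivariateGaussian m T).map (affineMeasurableEquiv L μ)) :=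
    Measure.isProbabilityMeasure_map (MeasurableEquiv.measurable _).aemeasurable
  refine Measure.ext_of_charFun (funext fun t => ?_)
  have hadj : ∀ x, inner ℝ (L x) t = inner ℝ x (toEuclideanCLM (𝕜 := ℝ) Aᵀ t) := fun x => by
    rw [hL, real_inner_comm, inner_toEuclideanCLM, inner_toEuclideanCLM, dotProduct_mulVec,
      mulVec_transpose, dotProduct_comm]
  have h1 := charFun_multivariateGaussian (μ := m) hT (toEuclideanCLM (𝕜 := ℝ) Aᵀ t)
  rw [charFun_apply] at h1
  rw [charFun_multivariateGaussian hT', charFun_apply, integral_map_equiv]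
  simp only [affineMeasurableEquiv_apply, inner_add_left, hadj, Complex.ofReal_add, add_mul,
    Complex.exp_add]
  rw [integral_const_mul, h1, ← Complex.exp_add]
  congr 1
  have e1 : inner ℝ (toEuclideanCLM (𝕜 := ℝ) Aᵀ t) m = inner ℝ t (L m) := by
    rw [real_inner_comm, ← hadj, real_inner_comm]
  have e2 : (toEuclideanCLM (𝕜 := ℝ) Aᵀ t).ofLp ⬝ᵥ T *ᵥ (toEuclideanCLM (𝕜 := ℝ) Aᵀ t).ofLp =
      t.ofLp ⬝ᵥ (A * T * Aᵀ) *ᵥ t.ofLp := by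
    rw [ofLp_toEuclideanCLM, ← mulVec_mulVec, ← mulVec_mulVec, dotProduct_mulVec t.ofLp A,
      mulVec_transpose]
  rw [e1, e2, inner_add_right, real_inner_comm]
  push_cast
  ring

end Matrix

/-! ### Algebra of the sample mean and covariance. -/

section Sample

open Matrix

variable {d n : ℕ}

/-- The columns of the data matrix whose rows are the `x i`. -/
def sampleColumns (x : Fin n → EuclideanSpace ℝ (Fin d)) :
    Fin d → EuclideanSpace ℝ (Fin n) :=
  fun k => WithLp.toLp 2 fun i => x i k

lemma continuous_sampleColumns :
    Continuous (sampleColumns : (Fin n → EuclideanSpace ℝ (Fin d)) → _) := by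
  unfold sampleColumns
  fun_prop

/-- The columns of a matrix with independent standard Gaussian rows are independent standard
Gaussian vectors. -/
lemma map_sampleColumns :
    (Measure.pi fun _ : Fin n => stdGaussian (EuclideanSpace ℝ (Fin d))).map sampleColumns =
      Measure.pi fun _ : Fin d => stdGaussian (EuclideanSpace ℝ (Fin n)) := by
  have : IsProbabilityMeasure ((Measure.pi fun _ : Fin n =>
      stdGaussian (EuclideanSpace ℝ (Fin d))).map sampleColumns) :=
    Measure.isProbabilityMeasure_map continuous_sampleColumns.measurable.aemeasurable
  refine charFun_eq_pi_iff.1 fun t => ?_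
  have h := charFun_pi (μ := fun _ : Fin n => stdGaussian (EuclideanSpace ℝ (Fin d)))
    (WithLp.toLp 2 (sampleColumns t.ofLp))
  rw [charFun_apply, integral_map (by fun_prop) (by fun_prop)] at h
  rw [charFun_apply, integral_map (by fun_prop) (by fun_prop),
    integral_map continuous_sampleColumns.measurable.aemeasurable (by fun_prop)]
  -- Transposing the data matrix preserves the entrywise inner product.
  have e : ∀ x : Fin n → EuclideanSpace ℝ (Fin d),
      inner ℝ (WithLp.toLp 2 (sampleColumns x)) t =
        inner ℝ (WithLp.toLp 2 x) (WithLp.toLp 2 (sampleColumns t.ofLp)) := fun x => by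
    simp only [PiLp.inner_apply, sampleColumns]
    exact Finset.sum_comm
  simp_rw [e]
  rw [h]
  simp only [charFun_stdGaussian]
  rw [← Complex.exp_sum, ← Complex.exp_sum]
  congr 1
  simp only [← Complex.ofReal_pow, EuclideanSpace.real_norm_sq_eq, sampleColumns,
    ← Complex.ofReal_neg, ← Complex.ofReal_ofNat, ← Complex.ofReal_div, ← Complex.ofReal_sum]
  congr 1
  rw [← Finset.sum_div, ← Finset.sum_div, Finset.sum_neg_distrib, Finset.sum_neg_distrib,
    Finset.sum_comm]

lemma sampleMean_apply (x : Fin n → EuclideanSpace ℝ (Fin d)) (k : Fin d) :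
    sampleMean x k = (n : ℝ)⁻¹ * ∑ i, x i k := by
  simp [sampleMean]

lemma sampleCov_apply (x : Fin n → EuclideanSpace ℝ (Fin d)) (k l : Fin d) :
    sampleCov x k l =
      (n : ℝ)⁻¹ * ∑ i, (x i k - sampleMean x k) * (x i l - sampleMean x l) := by
  simp [sampleCov, Matrix.sum_apply, vecMulVec_apply]

lemma posSemidef_sampleCov (x : Fin n → EuclideanSpace ℝ (Fin d)) :
    (sampleCov x).PosSemidef := by
  refine (posSemidef_sum _ fun i _ => ?_).smul (by positivity)
  simpa using posSemidef_vecMulVec_self_star (x i - sampleMean x).ofLp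

lemma sum_sub_sampleMean (hn : n ≠ 0) (x : Fin n → EuclideanSpace ℝ (Fin d)) :
    ∑ i, (x i - sampleMean x) = 0 := by
  rw [Finset.sum_sub_distrib, Finset.sum_const, sampleMean, Finset.card_univ, Fintype.card_fin,
    ← Nat.cast_smul_eq_nsmul ℝ, smul_smul, mul_inv_cancel₀ (by exact_mod_cast hn), one_smul,
    sub_self]

/-- The bias-variance decomposition; the cross term vanishes because deviations from the mean sum to
zero. -/
lemma trace_sampleCov_add_norm_sq (hn : n ≠ 0) (x : Fin n → EuclideanSpace ℝ (Fin d)) :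
    (sampleCov x).trace + ‖sampleMean x‖ ^ 2 = (n : ℝ)⁻¹ * ∑ i, ‖x i‖ ^ 2 := by
  have hn' : (n : ℝ) ≠ 0 := by exact_mod_cast hn
  have htr : (sampleCov x).trace = (n : ℝ)⁻¹ * ∑ i, ‖x i - sampleMean x‖ ^ 2 := by
    simp only [EuclideanSpace.real_norm_sq_eq, PiLp.sub_apply]
    simp only [Matrix.trace, Matrix.diag, sampleCov_apply, ← Finset.mul_sum, sq]
    rw [Finset.sum_comm]
  have hexp : ∀ i, ‖x i‖ ^ 2 = ‖x i - sampleMean x‖ ^ 2 +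
      2 * inner ℝ (x i - sampleMean x) (sampleMean x) + ‖sampleMean x‖ ^ 2 := fun i => by
    rw [← norm_add_sq_real, sub_add_cancel]
  simp_rw [htr, hexp]
  rw [Finset.sum_add_distrib, Finset.sum_add_distrib, ← Finset.mul_sum, ← sum_inner,
    sum_sub_sampleMean hn, inner_zero_left, Finset.sum_const, Finset.card_univ, Fintype.card_fin,
    nsmul_eq_mul]
  field_simp
  ring

/-- The constant vector with entries `1`. -/
noncomputable def onesVector (n : ℕ) : EuclideanSpace ℝ (Fin n) := WithLp.toLp 2 fun _ => 1

lemma inner_onesVector (u : EuclideanSpace ℝ (Fin n)) :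
    inner ℝ (onesVector n) u = ∑ i, u i := by
  simp [onesVector, PiLp.inner_apply]

lemma starProjection_orthogonal_onesVector (hn : n ≠ 0) (u : EuclideanSpace ℝ (Fin n)) :
    (Submodule.span ℝ {onesVector n})ᗮ.starProjection u =
      u - ((n : ℝ)⁻¹ * ∑ i, u i) • onesVector n := by
  have hn' : (n : ℝ) ≠ 0 := by exact_mod_cast hn
  refine (Submodule.eq_starProjection_of_mem_orthogonal
    (K := (Submodule.span ℝ {onesVector n})ᗮ) ?_ ?_)
  · rw [Submodule.mem_orthogonal_singleton_iff_inner_right, inner_sub_right, inner_smul_right,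
      inner_onesVector, inner_onesVector]
    simp only [onesVector, Finset.sum_const, Finset.card_univ, Fintype.card_fin, nsmul_eq_mul]
    field_simp
    ring
  · rw [Submodule.orthogonal_orthogonal, sub_sub_cancel]
    exact Submodule.smul_mem _ _ (Submodule.mem_span_singleton_self _)

/-- Centering a column is projecting it orthogonally to the ones vector. -/
lemma sampleCov_eq_smul_gram (hn : n ≠ 0) (x : Fin n → EuclideanSpace ℝ (Fin d)) :
    sampleCov x = (n : ℝ)⁻¹ • Matrix.gram ℝ fun k =>
      (Submodule.span ℝ {onesVector n})ᗮ.starProjection (sampleColumns x k) := by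
  ext k l
  rw [sampleCov_apply, Matrix.smul_apply, Matrix.gram_apply, smul_eq_mul,
    starProjection_orthogonal_onesVector hn, starProjection_orthogonal_onesVector hn]
  simp only [PiLp.inner_apply, sampleMean_apply, sampleColumns, onesVector]
  congr 1
  refine Finset.sum_congr rfl fun i _ => ?_
  simp [mul_comm]

lemma det_sampleCov (hn : n ≠ 0) (x : Fin n → EuclideanSpace ℝ (Fin d)) :
    (sampleCov x).det = ((n : ℝ)⁻¹) ^ d *
      orthogonalGramDet (Submodule.span ℝ {onesVector n}) (sampleColumns x) := by
  rw [sampleCov_eq_smul_gram hn, Matrix.det_smul, Fintype.card_fin, orthogonalGramDet]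

/-- With at most `d` observations the empirical covariance matrix is singular. -/
lemma exists_ne_zero_dotProduct_sampleCov_eq_zero (hd : 1 ≤ d) (hnd : n ≤ d)
    (x : Fin n → EuclideanSpace ℝ (Fin d)) :
    ∃ v : EuclideanSpace ℝ (Fin d), v ≠ 0 ∧ v.ofLp ⬝ᵥ sampleCov x *ᵥ v.ofLp = 0 := by
  have hquad : ∀ v : EuclideanSpace ℝ (Fin d), (∀ i, inner ℝ (x i - sampleMean x) v = 0) →
      v.ofLp ⬝ᵥ sampleCov x *ᵥ v.ofLp = 0 := fun v hv => by
    have : sampleCov x *ᵥ v.ofLp = 0 := by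
      rw [sampleCov, smul_mulVec, Matrix.sum_mulVec]
      refine smul_eq_zero_of_right _ (Finset.sum_eq_zero fun i _ => ?_)
      have h : (x i - sampleMean x).ofLp ⬝ᵥ v.ofLp = 0 := by
        rw [← hv i, PiLp.inner_apply, dotProduct]
        exact Finset.sum_congr rfl fun _ _ => mul_comm _ _
      rw [vecMulVec_mulVec, h]
      simp
    rw [this, dotProduct_zero]
  rcases Nat.eq_zero_or_pos n with rfl | hn
  · exact ⟨EuclideanSpace.single ⟨0, hd⟩ 1, by simp, hquad _ fun i => i.elim0⟩
  -- A hyperplane `⟪x i, v⟫ = c` through all points: `d + 1` unknowns `(v, c)` against `n ≤ d`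
  -- equations.
  let f : (EuclideanSpace ℝ (Fin d) × ℝ) →ₗ[ℝ] (Fin n → ℝ) :=
    LinearMap.pi fun i => ((innerₗ _ (x i)).comp (LinearMap.fst ℝ _ _)) - LinearMap.snd ℝ _ _
  have hker : LinearMap.ker f ≠ ⊥ := by
    refine LinearMap.ker_ne_bot_of_finrank_lt ?_
    simp
    omega
  obtain ⟨⟨v, c⟩, hvc, hne⟩ := (Submodule.ne_bot_iff _).1 hker
  have hvc' : ∀ i, inner ℝ (x i) v = c := fun i => by
    have := congrFun (LinearMap.mem_ker.1 hvc) i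
    simpa [f, sub_eq_zero] using this
  have hmean : inner ℝ (sampleMean x) v = c := by
    rw [sampleMean, real_inner_smul_left, sum_inner, Finset.sum_congr rfl fun i _ => hvc' i]
    have : (n : ℝ) ≠ 0 := by exact_mod_cast hn.ne'
    simp [this]
  refine ⟨v, ?_, hquad v fun i => by rw [inner_sub_left, hvc', hmean, sub_self]⟩
  rintro rfl
  refine hne ?_
  rw [← hvc' ⟨0, hn⟩, inner_zero_right]
  rfl

lemma sampleMean_affine (hn : n ≠ 0) (μ : EuclideanSpace ℝ (Fin d))
    (L : EuclideanSpace ℝ (Fin d) ≃L[ℝ] EuclideanSpace ℝ (Fin d))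
    (y : Fin n → EuclideanSpace ℝ (Fin d)) :
    sampleMean (fun i => μ + L (y i)) = μ + L (sampleMean y) := by
  have hn' : (n : ℝ) ≠ 0 := by exact_mod_cast hn
  rw [sampleMean, sampleMean, Finset.sum_add_distrib, map_smul, map_sum, smul_add,
    Finset.sum_const, Finset.card_univ, Fintype.card_fin, ← Nat.cast_smul_eq_nsmul ℝ, smul_smul,
    inv_mul_cancel₀ hn', one_smul]

lemma sampleCov_affine (hn : n ≠ 0) (μ : EuclideanSpace ℝ (Fin d))
    {L : EuclideanSpace ℝ (Fin d) ≃L[ℝ] EuclideanSpace ℝ (Fin d)}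
    {A : Matrix (Fin d) (Fin d) ℝ} (hL : ∀ x, L x = toEuclideanCLM (𝕜 := ℝ) A x)
    (y : Fin n → EuclideanSpace ℝ (Fin d)) :
    sampleCov (fun i => μ + L (y i)) = A * sampleCov y * Aᵀ := by
  rw [sampleCov, sampleCov, sampleMean_affine hn, Matrix.mul_smul, Matrix.smul_mul,
    Finset.mul_sum, Finset.sum_mul]
  congr 1
  refine Finset.sum_congr rfl fun i _ => ?_
  rw [add_sub_add_left_eq_sub, ← map_sub, hL, ofLp_toEuclideanCLM, mul_vecMulVec, vecMulVec_mul,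
    vecMul_transpose]

end Sample

/-! ### Expected divergence and the closed form. -/

section Risk

open Matrix

variable {d n : ℕ}

/-- The Kullback-Leibler divergence of the estimated distribution from the standard Gaussian
distribution, as a function of the sample. -/
noncomputable def sampleDivergence (y : Fin n → EuclideanSpace ℝ (Fin d)) : ℝ :=
  1 / 2 * ((n : ℝ)⁻¹ * ∑ i, ‖y i‖ ^ 2 - d - Real.log (sampleCov y).det)

lemma klDiv_sample_stdGaussian (hn : n ≠ 0) {y : Fin n → EuclideanSpace ℝ (Fin d)}
    (hy : 0 < orthogonalGramDet (Submodule.span ℝ {onesVector n}) (sampleColumns y)) :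
    klDiv (multivariateGaussian (sampleMean y) (sampleCov y))
      (stdGaussian (EuclideanSpace ℝ (Fin d))) = ENNReal.ofReal (sampleDivergence y) ∧
    0 ≤ sampleDivergence y := by
  have hn' : (0 : ℝ) < n := by exact_mod_cast Nat.pos_of_ne_zero hn
  have hdet : 0 < (sampleCov y).det := by
    rw [det_sampleCov hn]
    positivity
  have h := klDiv_multivariateGaussian_stdGaussian (sampleMean y)
    ((posSemidef_sampleCov y).posDef_iff_det_ne_zero.2 hdet.ne')
  rwa [trace_sampleCov_add_norm_sq hn] at h

lemma finrank_span_onesVector (hn : n ≠ 0) :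
    Module.finrank ℝ (Submodule.span ℝ {onesVector n}) = 1 := by
  refine finrank_span_singleton fun h => ?_
  have := congrArg (fun u : EuclideanSpace ℝ (Fin n) => u ⟨0, Nat.pos_of_ne_zero hn⟩) h
  simp [onesVector] at this

lemma finrank_span_onesVector_add_le (hn : d + 1 ≤ n) :
    Module.finrank ℝ (Submodule.span ℝ {onesVector n}) + d ≤
      Module.finrank ℝ (EuclideanSpace ℝ (Fin n)) := by
  rw [finrank_span_onesVector (by omega), finrank_euclideanSpace_fin]
  omega

lemma measurePreserving_sampleColumns :
    MeasurePreserving (sampleColumns : (Fin n → EuclideanSpace ℝ (Fin d)) → _)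
      (Measure.pi fun _ : Fin n => stdGaussian (EuclideanSpace ℝ (Fin d)))
      (Measure.pi fun _ : Fin d => stdGaussian (EuclideanSpace ℝ (Fin n))) :=
  ⟨continuous_sampleColumns.measurable, map_sampleColumns⟩

lemma ae_orthogonalGramDet_sampleColumns_pos (hn : d + 1 ≤ n) :
    ∀ᵐ y ∂(Measure.pi fun _ : Fin n => stdGaussian (EuclideanSpace ℝ (Fin d))),
      0 < orthogonalGramDet (Submodule.span ℝ {onesVector n}) (sampleColumns y) :=
  measurePreserving_sampleColumns.quasiMeasurePreserving.ae
    (ae_orthogonalGramDet_pos (finrank_span_onesVector_add_le hn))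

lemma integrable_and_integral_norm_sq_stdGaussian :
    Integrable (fun z => ‖z‖ ^ 2) (stdGaussian (EuclideanSpace ℝ (Fin d))) ∧
    ∫ z, ‖z‖ ^ 2 ∂(stdGaussian (EuclideanSpace ℝ (Fin d))) = d := by
  simpa using integrable_and_integral_norm_sq_add_toEuclideanCLM
    (0 : EuclideanSpace ℝ (Fin d)) 1

lemma integrable_and_integral_sampleDivergence (hn : d + 1 ≤ n) :
    Integrable (sampleDivergence : (Fin n → EuclideanSpace ℝ (Fin d)) → ℝ)
      (Measure.pi fun _ => stdGaussian (EuclideanSpace ℝ (Fin d))) ∧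
    ∫ y : Fin n → EuclideanSpace ℝ (Fin d), sampleDivergence y
      ∂(Measure.pi fun _ => stdGaussian (EuclideanSpace ℝ (Fin d))) =
      1 / 2 * (d * Real.log ((n : ℝ) / 2)
          - ∑ j ∈ Finset.Icc 1 d, realDigamma (((n : ℝ) - (j : ℝ)) / 2)) := by
  have hn0 : n ≠ 0 := by omega
  have hn' : (0 : ℝ) < n := by exact_mod_cast Nat.pos_of_ne_zero hn0
  set π := Measure.pi fun _ : Fin n => stdGaussian (EuclideanSpace ℝ (Fin d)) with hπ
  set V := Submodule.span ℝ {onesVector n} with hV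
  have hrank := finrank_span_onesVector_add_le hn
  have hq : ∀ i : Fin n, Integrable (fun y : Fin n → EuclideanSpace ℝ (Fin d) => ‖y i‖ ^ 2) π ∧
      ∫ y, ‖y i‖ ^ 2 ∂π = d := fun i => by
    have hmp := measurePreserving_eval
      (fun _ : Fin n => stdGaussian (EuclideanSpace ℝ (Fin d))) i
    have h := integrable_and_integral_norm_sq_stdGaussian (d := d)
    refine ⟨hmp.integrable_comp_of_integrable h.1, ?_⟩
    rw [← h.2, ← hmp.map_eq, integral_map hmp.measurable.aemeasurable (by fun_prop)]
  have hsum : Integrable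
      (fun y : Fin n → EuclideanSpace ℝ (Fin d) => (n : ℝ)⁻¹ * ∑ i, ‖y i‖ ^ 2 - d) π :=
    ((integrable_finsetSum _ fun i _ => (hq i).1).const_mul _).sub (integrable_const _)
  -- The quadratic part cancels in expectation, leaving only the log-determinant.
  have hsumv : ∫ y : Fin n → EuclideanSpace ℝ (Fin d), ((n : ℝ)⁻¹ * ∑ i, ‖y i‖ ^ 2 - d) ∂π
      = 0 := by
    rw [integral_sub ((integrable_finsetSum _ fun i _ => (hq i).1).const_mul _)
      (integrable_const _), integral_const_mul, integral_finsetSum _ fun i _ => (hq i).1]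
    simp only [(hq _).2, integral_const, probReal_univ, Finset.sum_const, Finset.card_univ,
      Fintype.card_fin, nsmul_eq_mul, smul_eq_mul]
    field_simp
    ring
  have hGi : Integrable (fun y => Real.log (orthogonalGramDet V (sampleColumns y))) π :=
    measurePreserving_sampleColumns.integrable_comp_of_integrable
      (integrable_log_orthogonalGramDet hrank)
  have hGv : ∫ y, Real.log (orthogonalGramDet V (sampleColumns y)) ∂π =
      ∑ j ∈ Finset.range d, (Real.log 2 + realDigamma (((n : ℝ) - 1 - j) / 2)) := by
    have h := integral_log_orthogonalGramDet hrank
    rw [finrank_span_onesVector hn0, finrank_euclideanSpace_fin, ← map_sampleColumns,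
      integral_map continuous_sampleColumns.measurable.aemeasurable
        (measurable_orthogonalGramDet V).log.aestronglyMeasurable] at h
    simpa using h
  have hdet : (fun y : Fin n → EuclideanSpace ℝ (Fin d) => Real.log (sampleCov y).det) =ᵐ[π]
      fun y => Real.log (orthogonalGramDet V (sampleColumns y)) - d * Real.log n := by
    filter_upwards [ae_orthogonalGramDet_sampleColumns_pos hn] with y hy
    rw [det_sampleCov hn0, Real.log_mul (by positivity) hy.ne', Real.log_pow, Real.log_inv]
    ring
  have hLi : Integrable
      (fun y : Fin n → EuclideanSpace ℝ (Fin d) => Real.log (sampleCov y).det) π :=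
    (integrable_congr hdet).2 (hGi.sub (integrable_const _))
  have hLv : ∫ y : Fin n → EuclideanSpace ℝ (Fin d), Real.log (sampleCov y).det ∂π =
      ∑ j ∈ Finset.range d, (Real.log 2 + realDigamma (((n : ℝ) - 1 - j) / 2))
        - d * Real.log n := by
    rw [integral_congr_ae hdet, integral_sub hGi (integrable_const _), hGv]
    simp
  refine ⟨(hsum.sub hLi).const_mul _, ?_⟩
  simp only [sampleDivergence]
  rw [integral_const_mul, integral_sub hsum hLi, hsumv, hLv, Finset.sum_add_distrib,
    Finset.sum_const, Finset.card_range, nsmul_eq_mul, Real.log_div hn'.ne' two_ne_zero]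
  have hreindex : ∑ j ∈ Finset.range d, realDigamma (((n : ℝ) - 1 - j) / 2) =
      ∑ j ∈ Finset.Icc 1 d, realDigamma (((n : ℝ) - (j : ℝ)) / 2) := by
    rw [← Finset.Ico_add_one_right_eq_Icc, Finset.sum_Ico_eq_sum_range]
    refine Finset.sum_congr (by simp) fun j _ => ?_
    push_cast
    ring_nf
  rw [hreindex]
  ring

variable {Ω : Type*} [MeasurableSpace Ω] {P : Measure Ω} [IsProbabilityMeasure P]
  {X : Fin n → Ω → EuclideanSpace ℝ (Fin d)} {μ : EuclideanSpace ℝ (Fin d)}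
  {S : Matrix (Fin d) (Fin d) ℝ}

/-- The closed form of the reverse Kullback-Leibler risk when `n ≥ d + 1`. -/
lemma reverseKLRisk_ne_top_and_toReal_eq (hS : S.PosDef)
    (hlaw : ∀ i, HasLaw (X i) (multivariateGaussian μ S) P) (hindep : iIndepFun X P)
    (hn : d + 1 ≤ n) :
    reverseKLRisk P X μ S ≠ ∞ ∧
      (reverseKLRisk P X μ S).toReal = 1 / 2 * (d * Real.log ((n : ℝ) / 2)
          - ∑ j ∈ Finset.Icc 1 d, realDigamma (((n : ℝ) - (j : ℝ)) / 2)) := by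
  have hn0 : n ≠ 0 := by omega
  obtain ⟨L, hL, -⟩ := exists_continuousLinearEquiv_of_det_ne_zero (det_sqrt_ne_zero hS)
  set e := affineMeasurableEquiv L μ with he
  have hG : multivariateGaussian μ S = (stdGaussian (EuclideanSpace ℝ (Fin d))).map e := by
    rw [multivariateGaussian]
    congr 1
    ext1 x
    rw [he, affineMeasurableEquiv_apply, hL]
  -- The whitened sample, with independent standard Gaussian entries.
  let Y : Ω → Fin n → EuclideanSpace ℝ (Fin d) := fun ω i => e.symm (X i ω)
  have hYm : ∀ i, AEMeasurable (fun ω => Y ω i) P :=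
    fun i => e.symm.measurable.comp_aemeasurable (hlaw i).aemeasurable
  have hYlaw : P.map Y = Measure.pi fun _ => stdGaussian (EuclideanSpace ℝ (Fin d)) := by
    have hind : iIndepFun (fun i ω => Y ω i) P :=
      hindep.comp (fun _ => e.symm) fun _ => e.symm.measurable
    rw [(iIndepFun_iff_map_fun_eq_pi_map hYm).1 hind]
    congr 1
    ext1 i
    have h := AEMeasurable.map_map_of_aemeasurable e.symm.measurable.aemeasurable
      (hlaw i).aemeasurable
    rw [(hlaw i).map_eq, hG, e.map_symm_map] at h
    exact h.symm
  have hYae : AEMeasurable Y P := aemeasurable_pi_iff.2 hYm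
  have hXY : ∀ ω, (fun i => X i ω) = fun i => μ + L (Y ω i) := fun ω => by
    ext1 i
    rw [← affineMeasurableEquiv_apply, ← he]
    exact (e.apply_symm_apply _).symm
  have hkl : ∀ ω, klDiv (multivariateGaussian (sampleMean fun i => X i ω)
      (sampleCov fun i => X i ω)) (multivariateGaussian μ S) =
      klDiv (multivariateGaussian (sampleMean (Y ω)) (sampleCov (Y ω)))
        (stdGaussian (EuclideanSpace ℝ (Fin d))) := fun ω => by
    rw [hXY, sampleMean_affine hn0, sampleCov_affine hn0 μ hL,
      ← map_affine_multivariateGaussian _ _ (posSemidef_sampleCov _) hL, hG, ← he,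
      klDiv_map_measurableEquiv]
  obtain ⟨hint, hval⟩ := integrable_and_integral_sampleDivergence hn
  have hae := ae_orthogonalGramDet_sampleColumns_pos hn
  have hnonneg : 0 ≤ᵐ[Measure.pi fun _ => stdGaussian (EuclideanSpace ℝ (Fin d))]
      (sampleDivergence : (Fin n → EuclideanSpace ℝ (Fin d)) → ℝ) := by
    filter_upwards [hae] with y hy using (klDiv_sample_stdGaussian hn0 hy).2
  have hrisk : reverseKLRisk P X μ S = ENNReal.ofReal (1 / 2 * (d * Real.log ((n : ℝ) / 2)
          - ∑ j ∈ Finset.Icc 1 d, realDigamma (((n : ℝ) - (j : ℝ)) / 2))) := by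
    have h1 : reverseKLRisk P X μ S = ∫⁻ ω, ENNReal.ofReal (sampleDivergence (Y ω)) ∂P := by
      refine lintegral_congr_ae ?_
      rw [← hYlaw] at hae
      filter_upwards [ae_of_ae_map hYae hae] with ω hω
      rw [hkl, (klDiv_sample_stdGaussian hn0 hω).1]
    rw [h1, ← lintegral_map' (f := fun y => ENNReal.ofReal (sampleDivergence y)) ?_ hYae, hYlaw,
      ← ofReal_integral_eq_lintegral_ofReal hint hnonneg, hval]
    rw [hYlaw]
    exact hint.aemeasurable.ennreal_ofReal
  rw [hrisk]
  refine ⟨ENNReal.ofReal_ne_top, ENNReal.toReal_ofReal ?_⟩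
  -- The closed form is nonnegative as the integral of a divergence, so `ENNReal.ofReal` truncates
  -- nothing.
  rw [← hval]
  exact integral_nonneg_of_ae hnonneg


end Risk

theorem proposition7 {d : ℕ} (hd : 1 ≤ d)
    (μ : EuclideanSpace ℝ (Fin d)) (S : Matrix (Fin d) (Fin d) ℝ) (hS : S.PosDef)
    {Ω : ℕ → Type*} [∀ n, MeasurableSpace (Ω n)]
    (P : ∀ n, Measure (Ω n)) [∀ n, IsProbabilityMeasure (P n)]
    (X : ∀ n, Fin n → Ω n → EuclideanSpace ℝ (Fin d))
    (hlaw : ∀ n i, HasLaw (X n i) (multivariateGaussian μ S) (P n))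
    (hindep : ∀ n, iIndepFun (X n) (P n)) :
    (∀ n : ℕ, d + 1 ≤ n →
      reverseKLRisk (P n) (X n) μ S ≠ ∞ ∧
      (reverseKLRisk (P n) (X n) μ S).toReal =
        1 / 2 * (d * Real.log ((n : ℝ) / 2)
          - ∑ j ∈ Finset.Icc 1 d, realDigamma (((n : ℝ) - (j : ℝ)) / 2))) ∧
    StrictAntiOn (fun n : ℕ => reverseKLRisk (P n) (X n) μ S) (Set.Ici (d + 1)) ∧
    (∀ n : ℕ, n ≤ d → reverseKLRisk (P n) (X n) μ S = ∞) := by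
  have hclosed n (hn : d + 1 ≤ n) :=
    reverseKLRisk_ne_top_and_toReal_eq hS (hlaw n) (hindep n) hn
  refine ⟨hclosed, fun a ha b hb hab => ?_, fun n hn => ?_⟩
  · obtain ⟨hfa, hva⟩ := hclosed a ha
    obtain ⟨hfb, hvb⟩ := hclosed b hb
    -- Only the closed forms are compared, so samples of different sizes may live on unrelated
    -- probability spaces.
    rw [← ENNReal.toReal_lt_toReal hfb hfa, hva, hvb]
    exact strictAntiOn_log_sub_sum_realDigamma hd ha hb hab
  -- The divergence is infinite for every outcome, and `P n` has mass one.
  · have htop : ∀ ω, klDiv (multivariateGaussian (sampleMean fun i => X n i ω)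
        (sampleCov fun i => X n i ω)) (multivariateGaussian μ S) = ∞ := fun ω => by
      obtain ⟨v, hv, hTv⟩ := exists_ne_zero_dotProduct_sampleCov_eq_zero hd hn fun i => X n i ω
      exact klDiv_multivariateGaussian_eq_top _ _ hS (posSemidef_sampleCov _) hv hTv
    simp [reverseKLRisk, htop]
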